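/- Let $N\ge 1$ and let $(x_1,y_1),\dots,(x_N,y_N)\in\mathbb R^d\times\{\pm1\}$ be training examples with $x_1,\dots,x_N$ linearly independent. Put $X=[y_1x_1,\dots,y_Nx_N]\in\mathbb R^{d\times N}$, let $\sigma_{\max}(X)$ be its largest singular value, let $\ell(z)=\ln(1+e^{-z})$ be the logistic loss, and let $\beta=\frac14$ (the smoothness coefficient of $\ell$). Then there is a unique $\alpha\in\mathbb R^N$ with $X^\top X\alpha=(1,\dots,1)^\top$. Suppose moreover that all $\alpha_i>0$, and put $\hat w=X\alpha$ and $\gamma^*=\big(\sum_{i=1}^N\alpha_i\big)^{-1/2}$. Then: (a) $\gamma^*=\max_{\|w\|_2=1}\min_{1\le i\le N}y_iw^\top x_i$, and this maximum is attained only at $w=\hat w/\|\hat w\|_2$ (so $\hat w$ is the max-margin direction). (b) Let $K\ge1$ be a divisor of $N$, let $$0<\eta<\min\left\{\frac{1}{2K\beta\sigma_{\max}^2(X)},\ \frac{\gamma^*}{2\beta\sigma_{\max}^3(X)\,\big(K+\sigma_{\max}(X)/\gamma^*\big)}\right\},$$ and let $w_0\in\mathbb R^d$. Then there is $\tilde w\in\mathbb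 R^d$ with $\exp(-y_i\tilde w^\top x_i)=\alpha_i/\eta$ for all $i$ such that the following holds for every sequence $(B_t)_{t\ge0}$ of minibatches $B_t\subseteq\{1,\dots,N\}$ of size $N/K$ for which, in each epoch of $K$ iterations $t=eK,\dots,eK+K-1$ ($e=0,1,2,\dots$), every example lies in exactly one minibatch. The SGD iterates $$w_{t+1}=w_t-\eta\,\nabla_w\Big(\sum_{i\in B_t}\ell(y_iw^\top x_i)\Big)\Big|_{w=w_t}$$ satisfy $$\lim_{t\to\infty}\left\|w_t-\ln\left(\tfrac tK\right)\hat w-\tilde w\right\|_2=0,$$ and each example's share of the total loss converges: for every $1\le i\le N$, $$\lim_{t\to\infty}\frac{\ell(y_iw_t^\top x_i)}{\sum_{j=1}^N\ell(y_jw_t^\top x_j)}=\frac{\alpha_i}{\sum_{j=1}^N\alpha_j}.$$ -/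

import Mathlib

open Filter Topology
open scoped Matrix RealInnerProductSpace

noncomputable section

namespace MinibatchSGD

/-- The logistic loss `ℓ(z) = ln (1 + exp (-z))`. -/
def logisticLoss (z : ℝ) : ℝ := Real.log (1 + Real.exp (-z))

/-- The smoothness coefficient `β = 1/4` of the logistic loss. -/
def beta : ℝ := 1 / 4

variable {d N : ℕ}

/-- The loss `ℓ(y_i f_w(x_i))` of the `i`-th example under the linear model `f_w(x) = wᵀx`. -/
def exampleLoss (x : Fin N → EuclideanSpace ℝ (Fin d)) (y : Fin N → ℝ)
    (w : EuclideanSpace ℝ (Fin d)) (i : Fin N) : ℝ :=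
  logisticLoss (y i * ⟪w, x i⟫)

/-- The part of the training objective `∑ i, ℓ(y_i f_w(x_i))` carried by the minibatch `S`. -/
def batchLoss (x : Fin N → EuclideanSpace ℝ (Fin d)) (y : Fin N → ℝ)
    (S : Finset (Fin N)) (w : EuclideanSpace ℝ (Fin d)) : ℝ :=
  ∑ i ∈ S, exampleLoss x y w i

/-- The SGD iterates with constant learning rate `η`, initialization `w₀`, and minibatch
`batch t` used in the step from `w_t` to `w_{t+1}`. -/
def sgd (x : Fin N → EuclideanSpace ℝ (Fin d)) (y : Fin N → ℝ) (η : ℝ)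
    (batch : ℕ → Finset (Fin N)) (w₀ : EuclideanSpace ℝ (Fin d)) :
    ℕ → EuclideanSpace ℝ (Fin d)
  | 0 => w₀
  | t + 1 => sgd x y η batch w₀ t
      - η • gradient (batchLoss x y (batch t)) (sgd x y η batch w₀ t)

/-- Epoch-wise minibatches: every minibatch has size `N / K`, and in every epoch `e`, consisting
of the `K` iterations `e * K, …, e * K + K - 1`, every example is in exactly one minibatch.
The partition into minibatches may differ from epoch to epoch. -/
structure IsEpochwise (K : ℕ) (batch : ℕ → Finset (Fin N)) : Prop where
  card_eq : ∀ t, (batch t).card = N / K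
  existsUnique_mem : ∀ (e : ℕ) (i : Fin N), ∃! j : Fin K, i ∈ batch (e * K + j)

/-- The matrix `X = [y_1 x_1, …, y_N x_N]`, of size `d × N`. -/
def dataMatrix (x : Fin N → EuclideanSpace ℝ (Fin d)) (y : Fin N → ℝ) :
    Matrix (Fin d) (Fin N) ℝ :=
  Matrix.of fun k i => y i * x i k

/-- The largest singular value of a real matrix (Mathlib lists singular values in
decreasing order, starting from index `0`). -/
def sigmaMax (A : Matrix (Fin d) (Fin N) ℝ) : ℝ :=
  (Matrix.toEuclideanLin A).singularValues 0

/-- The margin `min_i y_i wᵀx_i` of `w` on the training set (used for `N ≥ 1`). -/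
def margin (x : Fin N → EuclideanSpace ℝ (Fin d)) (y : Fin N → ℝ)
    (w : EuclideanSpace ℝ (Fin d)) : ℝ :=
  ⨅ i, y i * ⟪w, x i⟫

/-- `γ* = (∑ i, α_i) ^ (-1/2)`. -/
def gammaStar (α : Fin N → ℝ) : ℝ := (∑ i, α i) ^ (-(1 / 2) : ℝ)

/-- `ŵ = X α`. -/
def wHat (x : Fin N → EuclideanSpace ℝ (Fin d)) (y : Fin N → ℝ) (α : Fin N → ℝ) :
    EuclideanSpace ℝ (Fin d) :=
  WithLp.toLp 2 (dataMatrix x y *ᵥ α)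

end MinibatchSGD

end

/-! Write `z i = y i • x i`, `s = -ℓ'` and `ŵ = ∑ α i • z i`, so that `⟪ŵ, z i⟫ = 1` for all `i`.

Margin: pairing with `ŵ` gives `‖ŵ‖² = ∑ α i`. The minimal margin of a unit vector is at most its
`α`-weighted mean, which is `⟪w, ŵ⟫ / ‖ŵ‖²`; Cauchy–Schwarz bounds this by `‖ŵ‖⁻¹`, with equality
only in the direction of `ŵ`.

Rate: for small `η` an epoch is a full gradient step with a small relative error, so the total loss
`L` drops by `η/7 * ‖∇L‖²` (`IsEpoch.totalLoss_le`). As `‖∇L‖ ≥ γ* ∑ s`, which dominates a multiple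
of `L`, this gives `L = O(1/e)` after `e` epochs. Hence `exp(-margin)` and the drift inside an epoch
are `O(1/e)`, and the slopes met during the epoch equal `exp(-margin) + O(1/e²)`
(`exists_online_slope_sub_exp_le`).

Limit: let `r` be the residual `w - log e • ŵ - w̃` at the start of epoch `e` and `p i = ⟪r, z i⟫`.
By the choice of `w̃`, `r` moves by `∑ (α i / e) (exp(-p i) - 1) • z i + O(1/e²)`, so `‖r‖²` loses
`(2/e) ∑ α i p i (1 - exp(-p i))` up to summable errors (`exists_norm_residual_sq_le`). This first
bounds `r`; the loss is then at least a multiple of `‖r‖²/e`, because `r` stays in the span of the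
`z i`. Divergence of the harmonic series forces `r → 0` (`tendsto_residual`). The loss shares follow
from `ℓ(m) ~ exp(-m)`. -/

namespace MinibatchSGD

/-! ### Scalar estimates for the logistic loss. -/

section Scalar

/-- Minus the derivative of the logistic loss. -/
noncomputable def lossSlope (m : ℝ) : ℝ := Real.sigmoid (-m)

lemma lossSlope_eq (m : ℝ) : lossSlope m = (1 + Real.exp m)⁻¹ := by
  simp [lossSlope, Real.sigmoid_def]

lemma lossSlope_pos (m : ℝ) : 0 < lossSlope m := Real.sigmoid_pos _

lemma lossSlope_lt_one (m : ℝ) : lossSlope m < 1 := Real.sigmoid_lt_one _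

lemma lossSlope_le_exp (m : ℝ) : lossSlope m ≤ Real.exp (-m) := by
  rw [lossSlope_eq, Real.exp_neg]
  exact inv_anti₀ (Real.exp_pos _) (by linarith)

lemma exp_neg_sub_lossSlope (m : ℝ) :
    |lossSlope m - Real.exp (-m)| ≤ Real.exp (-m) ^ 2 := by
  have h : lossSlope m - Real.exp (-m) = -(lossSlope m * Real.exp (-m)) := by
    rw [lossSlope_eq, Real.exp_neg]
    have := Real.exp_pos m
    field_simp
    ring
  rw [h, abs_neg, abs_of_pos (mul_pos (lossSlope_pos m) (Real.exp_pos _)), sq]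
  exact mul_le_mul_of_nonneg_right (lossSlope_le_exp m) (Real.exp_pos _).le

lemma hasDerivAt_lossSlope (m : ℝ) :
    HasDerivAt lossSlope (-(lossSlope m * (1 - lossSlope m))) m := by
  have := (Real.hasDerivAt_sigmoid (-m)).comp m (hasDerivAt_neg m)
  refine this.congr_deriv ?_
  unfold lossSlope
  ring

lemma lossSlope_lipschitz (a b : ℝ) : |lossSlope b - lossSlope a| ≤ 1 / 4 * |b - a| := by
  refine Convex.norm_image_sub_le_of_norm_hasDerivWithin_le (s := Set.univ)
    (fun m _ => (hasDerivAt_lossSlope m).hasDerivWithinAt) (fun m _ => ?_) convex_univ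
    (Set.mem_univ _) (Set.mem_univ _)
  have h0 := lossSlope_pos m
  have h1 := lossSlope_lt_one m
  rw [norm_neg, Real.norm_eq_abs, abs_of_nonneg (mul_nonneg h0.le (by linarith))]
  nlinarith [sq_nonneg (lossSlope m - 1 / 2)]

/-- Multiplicative control of the slope: unlike the Lipschitz bound, it yields an error proportional
to the slope itself, which gains a factor `1/e` later. -/
lemma lossSlope_le_exp_mul (a b : ℝ) :
    lossSlope b ≤ Real.exp |b - a| * lossSlope a := by
  rw [lossSlope_eq, lossSlope_eq, ← div_eq_mul_inv, le_div_iff₀ (by positivity),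
    inv_mul_eq_div, div_le_iff₀ (by positivity)]
  have h1 : 1 ≤ Real.exp |b - a| := Real.one_le_exp (abs_nonneg _)
  have h2 : Real.exp a ≤ Real.exp |b - a| * Real.exp b := by
    rw [← Real.exp_add]
    exact Real.exp_le_exp.2 (by linarith [neg_abs_le (b - a)])
  linarith

lemma abs_lossSlope_sub_le (a b : ℝ) :
    |lossSlope b - lossSlope a| ≤ lossSlope a * (Real.exp |b - a| - 1) := by
  have h1 := lossSlope_le_exp_mul a b
  have h2 := lossSlope_le_exp_mul b a
  have h3 := lossSlope_pos a
  have h4 := lossSlope_pos b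
  rw [abs_sub_comm a b] at h2
  have h5 : 1 ≤ Real.exp |b - a| := Real.one_le_exp (abs_nonneg _)
  rw [abs_le]
  constructor
  · rcases le_total (lossSlope b) (lossSlope a) with h | h <;> nlinarith
  · nlinarith

lemma hasDerivAt_logisticLoss (m : ℝ) : HasDerivAt logisticLoss (-lossSlope m) m := by
  have h1 : HasDerivAt (fun m : ℝ => 1 + Real.exp (-m)) (Real.exp (-m) * (-1)) m :=
    ((hasDerivAt_neg m).exp).const_add 1
  have h2 := h1.log (by positivity)
  unfold logisticLoss
  convert h2 using 1
  rw [lossSlope_eq, Real.exp_neg]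
  have := Real.exp_pos m
  field_simp
  ring

lemma logisticLoss_pos (m : ℝ) : 0 < logisticLoss m :=
  Real.log_pos (by linarith [Real.exp_pos (-m)])

lemma exp_logisticLoss (m : ℝ) : Real.exp (logisticLoss m) = 1 + Real.exp (-m) :=
  Real.exp_log (by positivity)

lemma logisticLoss_le_exp (m : ℝ) : logisticLoss m ≤ Real.exp (-m) := by
  have := Real.log_le_sub_one_of_pos (show 0 < 1 + Real.exp (-m) by positivity)
  unfold logisticLoss
  linarith

/-- With `l = ℓ(m)`, `exp(-m) = exp l - 1 ≤ l * exp l`. -/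
lemma exp_neg_le_logisticLoss (m : ℝ) :
    Real.exp (-m) ≤ logisticLoss m * Real.exp (logisticLoss m) := by
  have h1 := exp_logisticLoss m
  have h2 := Real.add_one_le_exp (-logisticLoss m)
  rw [Real.exp_neg] at h2
  have h3 := Real.exp_pos (logisticLoss m)
  have h4 : (-logisticLoss m + 1) * Real.exp (logisticLoss m) ≤ 1 := by
    calc _ ≤ (Real.exp (logisticLoss m))⁻¹ * Real.exp (logisticLoss m) := by gcongr
      _ = 1 := inv_mul_cancel₀ h3.ne'
  linarith

/-- With `l = ℓ(m)`, the slope is `1 - exp(-l) ≥ l / (1 + l)`. This lets the gradient control the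
loss when the loss is bounded. -/
lemma logisticLoss_le_lossSlope (m : ℝ) :
    logisticLoss m ≤ (1 + logisticLoss m) * lossSlope m := by
  have h1 := exp_logisticLoss m
  have h2 := Real.add_one_le_exp (logisticLoss m)
  have hl := logisticLoss_pos m
  have h5 : lossSlope m = 1 - (1 + Real.exp (-m))⁻¹ := by
    rw [lossSlope_eq, Real.exp_neg]
    have := Real.exp_pos m
    field_simp
    ring
  have h6 : (1 + Real.exp (-m))⁻¹ ≤ (1 + logisticLoss m)⁻¹ :=
    inv_anti₀ (by linarith) (by linarith)
  have h7 : (1 + logisticLoss m) * (1 + logisticLoss m)⁻¹ = 1 :=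
    mul_inv_cancel₀ (by linarith)
  rw [h5]
  nlinarith

/-- The function `z²/8 - ℓ(z)` is convex, since its derivative `z/4 + s(z)` is monotone by the
Lipschitz bound; hence it lies above its tangents. -/
lemma logisticLoss_le_quadratic (a b : ℝ) :
    logisticLoss b ≤ logisticLoss a - lossSlope a * (b - a) + (b - a) ^ 2 / 8 := by
  have hd : ∀ z, HasDerivAt (fun z => z ^ 2 / 8 - logisticLoss z) (z / 4 + lossSlope z) z := by
    intro z
    have := (((hasDerivAt_id z).pow 2).div_const 8).sub (hasDerivAt_logisticLoss z)
    refine this.congr_deriv ?_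
    simp
    ring
  have hmono : Monotone (fun z => z / 4 + lossSlope z) := by
    intro p q hpq
    have := lossSlope_lipschitz p q
    rw [abs_of_nonneg (sub_nonneg.2 hpq)] at this
    have := (abs_le.1 this).1
    simp only
    linarith
  have hc : ConvexOn ℝ Set.univ (fun z => z ^ 2 / 8 - logisticLoss z) := by
    refine Monotone.convexOn_univ_of_deriv (fun z => (hd z).differentiableAt) ?_
    rwa [show deriv (fun z => z ^ 2 / 8 - logisticLoss z) = _ from funext fun z => (hd z).deriv]
  rcases lt_trichotomy a b with h | h | h
  · have := hc.le_slope_of_hasDerivAt (Set.mem_univ a) (Set.mem_univ b) h (hd a)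
    rw [slope_def_field, le_div_iff₀ (by linarith)] at this
    nlinarith
  · subst h; simp
  · have := hc.slope_le_of_hasDerivAt (Set.mem_univ b) (Set.mem_univ a) h (hd a)
    rw [slope_def_field, div_le_iff₀ (by linarith)] at this
    nlinarith

/-- Coercivity of the dissipation term: quadratic for bounded `p`. -/
lemma mul_one_sub_exp_neg_ge (p : ℝ) : p ^ 2 / (1 + |p|) ≤ p * (1 - Real.exp (-p)) := by
  rw [div_le_iff₀ (by positivity)]
  rcases le_total 0 p with h | h
  · rw [abs_of_nonneg h]
    have h1 := Real.add_one_le_exp p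
    have h2 : Real.exp p * Real.exp (-p) = 1 := by rw [← Real.exp_add]; simp
    have h3 := Real.exp_pos (-p)
    have h4 : (1 + p) * Real.exp (-p) ≤ 1 := by nlinarith
    nlinarith [mul_nonneg h (sub_nonneg.2 h4)]
  · rw [abs_of_nonpos h]
    have h1 := Real.add_one_le_exp (-p)
    have h2 : p ^ 2 ≤ p * (1 - Real.exp (-p)) := by nlinarith
    nlinarith [mul_nonneg (neg_nonneg.2 h) (le_trans (sq_nonneg p) h2)]

lemma abs_inv_sub_log_le {e : ℝ} (he : 0 < e) :
    |1 / e - (Real.log (e + 1) - Real.log e)| ≤ 1 / e ^ 2 := by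
  rw [← Real.log_div (by linarith) he.ne']
  have h1 := Real.log_le_sub_one_of_pos (show 0 < (e + 1) / e by positivity)
  have h2 := Real.one_sub_inv_le_log_of_pos (show 0 < (e + 1) / e by positivity)
  have h3 : (e + 1) / e - 1 = 1 / e := by field_simp; ring
  have h4 : 1 - ((e + 1) / e)⁻¹ = 1 / (e + 1) := by field_simp; ring
  have h5 : 1 / e - 1 / (e + 1) ≤ 1 / e ^ 2 := by
    rw [div_sub_div _ _ he.ne' (by linarith), div_le_div_iff₀ (by positivity) (by positivity)]
    nlinarith
  rw [abs_le]
  constructor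
  · have : 0 < 1 / e ^ 2 := by positivity
    linarith
  · linarith

end Scalar

/-! ### Real recursions with steps of order `1/e`. -/

section Sequences

/-- The reciprocal `(L e)⁻¹` grows by at least `c` in each step. -/
lemma le_div_of_le_sub_sq {L : ℕ → ℝ} {c : ℝ} (hc : 0 < c) (hL : ∀ e, 0 < L e)
    (h : ∀ e, L (e + 1) ≤ L e - c * L e ^ 2) (e : ℕ) : L e * (c * e) ≤ 1 := by
  have key : ∀ e : ℕ, c * e ≤ (L e)⁻¹ := by
    intro e
    induction e with
    | zero => simpa using (hL 0).le
    | succ n ih =>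
      have h0 := hL n
      have h1 := hL (n + 1)
      have h2 := h n
      have h3 : c ≤ (L (n + 1))⁻¹ - (L n)⁻¹ := by
        rw [inv_sub_inv h1.ne' h0.ne', le_div_iff₀ (by positivity)]
        have : L (n + 1) ≤ L n := by nlinarith [mul_pos hc (pow_pos h0 2)]
        nlinarith [mul_le_mul_of_nonneg_left this (mul_pos hc h0).le]
      push_cast
      linarith
  calc L e * (c * e) ≤ L e * (L e)⁻¹ := mul_le_mul_of_nonneg_left (key e) (hL e).le
    _ = 1 := mul_inv_cancel₀ (hL e).ne'

lemma one_div_sq_le_telescope {e : ℝ} (he : 1 ≤ e) :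
    1 / e ^ 2 ≤ 2 / e - 2 / (e + 1) := by
  rw [div_sub_div _ _ (by linarith) (by linarith), div_le_div_iff₀ (by positivity) (by positivity)]
  nlinarith [mul_nonneg (sub_nonneg.2 he) (sq_nonneg e)]

/-- Discrete Grönwall: by the telescoping bound for `1/e²`, the quantity `(1 + V e) * exp(2C/e)`
does not increase. -/
lemma exists_bound_of_le_one_add {V : ℕ → ℝ} {C : ℝ} (hC : 0 ≤ C) (hV : ∀ e, 0 ≤ V e)
    (h : ∀ e : ℕ, 1 ≤ e → V (e + 1) ≤ V e + C / (e : ℝ) ^ 2 * (1 + V e)) :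
    ∃ B, ∀ e : ℕ, 1 ≤ e → V e ≤ B := by
  have key : ∀ e : ℕ, 1 ≤ e → (1 + V e) * Real.exp (2 * C / e) ≤ (1 + V 1) * Real.exp (2 * C) := by
    intro e he
    induction e, he using Nat.le_induction with
    | base => simp
    | succ e he ih =>
      refine le_trans ?_ ih
      have he' : (1 : ℝ) ≤ e := by exact_mod_cast he
      have h1 : 1 + V (e + 1) ≤ (1 + V e) * Real.exp (C / (e : ℝ) ^ 2) := by
        have := Real.add_one_le_exp (C / (e : ℝ) ^ 2)
        have h2 := h e he
        have h3 := hV e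
        nlinarith
      calc (1 + V (e + 1)) * Real.exp (2 * C / (e + 1 : ℕ))
          ≤ (1 + V e) * Real.exp (C / (e : ℝ) ^ 2) * Real.exp (2 * C / (e + 1 : ℕ)) := by gcongr
        _ = (1 + V e) * Real.exp (C / (e : ℝ) ^ 2 + 2 * C / (e + 1 : ℕ)) := by
            rw [Real.exp_add]; ring
        _ ≤ (1 + V e) * Real.exp (2 * C / e) := by
            have h4 := hV e
            gcongr
            have := mul_le_mul_of_nonneg_left (one_div_sq_le_telescope he') hC
            push_cast
            have e1 : C * (1 / (e : ℝ) ^ 2) = C / (e : ℝ) ^ 2 := by ring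
            have e2 : C * (2 / (e : ℝ) - 2 / (e + 1)) = 2 * C / e - 2 * C / (e + 1) := by ring
            linarith
  refine ⟨(1 + V 1) * Real.exp (2 * C), fun e he => ?_⟩
  have h1 : 1 ≤ Real.exp (2 * C / e) := Real.one_le_exp (by positivity)
  have h2 := hV e
  nlinarith [key e he]

/-- Adding `2C/e` absorbs the error and makes `V` nonincreasing, so `V` converges and `∑ V e / e` is
finite. A positive limit would contradict divergence of the harmonic series. -/
lemma tendsto_zero_of_le_sub_div {V : ℕ → ℝ} {c C : ℝ} (hc : 0 < c) (hC : 0 ≤ C)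
    (hV : ∀ e, 0 ≤ V e)
    (h : ∀ e : ℕ, 1 ≤ e → V (e + 1) ≤ V e - c / e * V e + C / (e : ℝ) ^ 2) :
    Tendsto V atTop (𝓝 0) := by
  set U : ℕ → ℝ := fun n => V (n + 1) + 2 * C / (n + 1 : ℕ) with hU
  have hU0 : ∀ n, 0 ≤ U n := fun n => add_nonneg (hV _) (by positivity)
  have hstep : ∀ n, U (n + 1) ≤ U n - c * (V (n + 1) / (n + 1 : ℕ)) := by
    intro n
    have h1 := h (n + 1) (by omega)
    have he' : (1 : ℝ) ≤ ((n + 1 : ℕ) : ℝ) := by exact_mod_cast Nat.succ_le_succ (Nat.zero_le n)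
    have h2 := mul_le_mul_of_nonneg_left (one_div_sq_le_telescope he') hC
    simp only [hU]
    rw [show ((n + 1 + 1 : ℕ) : ℝ) = ((n + 1 : ℕ) : ℝ) + 1 by push_cast; ring]
    generalize ((n + 1 : ℕ) : ℝ) = e at *
    have e1 : C * (1 / (e : ℝ) ^ 2) = C / (e : ℝ) ^ 2 := by ring
    have e2 : C * (2 / (e : ℝ) - 2 / (e + 1)) = 2 * C / e - 2 * C / (e + 1) := by ring
    have e3 : c * (V (n + 1) / e) = c / e * V (n + 1) := by ring
    linarith
  have hanti : Antitone U := antitone_nat_of_succ_le fun n => by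
    have : 0 ≤ c * (V (n + 1) / (n + 1 : ℕ)) :=
      mul_nonneg hc.le (div_nonneg (hV _) (by positivity))
    linarith [hstep n]
  have hlim := tendsto_atTop_ciInf hanti ⟨0, by rintro _ ⟨n, rfl⟩; exact hU0 n⟩
  set l := ⨅ n, U n
  have hCe : Tendsto (fun n : ℕ => 2 * C / ((n + 1 : ℕ) : ℝ)) atTop (𝓝 0) :=
    (tendsto_const_div_atTop_nhds_zero_nat (2 * C)).comp (tendsto_add_atTop_nat 1)
  have hVl : Tendsto (fun n => V (n + 1)) atTop (𝓝 l) := by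
    have := hlim.sub hCe
    simpa [hU] using this
  have hl0 : 0 ≤ l := ge_of_tendsto' hVl fun n => hV _
  have hsum : Summable fun n : ℕ => V (n + 1) / (n + 1 : ℕ) := by
    refine summable_of_sum_range_le (c := U 0 / c)
      (fun n => div_nonneg (hV _) (by positivity)) fun n => ?_
    have : U n ≤ U 0 - c * ∑ i ∈ Finset.range n, V (i + 1) / (i + 1 : ℕ) := by
      induction n with
      | zero => simp
      | succ n ih => rw [Finset.sum_range_succ, mul_add]; linarith [hstep n]
    rw [le_div_iff₀ hc]
    linarith [hU0 n]
  rcases hl0.eq_or_lt with hl | hl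
  · rw [← hl] at hVl
    exact (tendsto_add_atTop_iff_nat 1).1 hVl
  · exfalso
    have hev : ∀ᶠ n in atTop, l / 2 < V (n + 1) := hVl.eventually_const_lt (by linarith)
    obtain ⟨n₀, hn₀⟩ := eventually_atTop.1 hev
    have hs2 : Summable fun n : ℕ => l / 2 * (1 / ((n + n₀ + 1 : ℕ) : ℝ)) := by
      refine Summable.of_nonneg_of_le (fun n => by positivity) (fun n => ?_)
        ((summable_nat_add_iff n₀).2 hsum)
      rw [mul_one_div]
      exact div_le_div_of_nonneg_right (hn₀ (n + n₀) (by omega)).le (by positivity)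
    rw [summable_mul_left_iff (by positivity)] at hs2
    exact Real.not_summable_one_div_natCast ((summable_nat_add_iff (n₀ + 1)).1 hs2)

end Sequences

/-! ### One epoch as a perturbed full gradient step. -/

section Epoch

variable {ι : Type*} [Fintype ι] {E : Type*} [NormedAddCommGroup E] [InnerProductSpace ℝ E]

/-- A learning rate `η` that is small enough for signed examples `z` whose singular values are
at most `σ` and whose margin is at least `γ`, when epochs have `K` iterations. -/
structure IsAdmissible (z : ι → E) (σ γ η : ℝ) (K : ℕ) : Prop where
  eta_pos : 0 < η
  gamma_pos : 0 < γ
  gamma_le_sigma : γ ≤ σ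
  eta_mul_sq_le : η * σ ^ 2 ≤ 1
  sq_mul_le : (η * σ ^ 2 / 4) ^ 2 * K * σ ^ 2 ≤ γ ^ 2 / 16
  norm_sq_le : ∀ v : ι → ℝ, ‖∑ i, v i • z i‖ ^ 2 ≤ σ ^ 2 * ∑ i, v i ^ 2
  sum_inner_sq_le : ∀ w : E, ∑ i, ⟪w, z i⟫ ^ 2 ≤ σ ^ 2 * ‖w‖ ^ 2
  mul_sum_le : ∀ v : ι → ℝ, γ * ∑ i, v i ≤ ‖∑ i, v i • z i‖

/-- `w 0, …, w K` are the iterates of an epoch in which the example `i` is used in the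
iteration `κ i`. -/
structure IsEpoch (z : ι → E) (η : ℝ) (K : ℕ) (κ : ι → ℕ) (w : ℕ → E) : Prop where
  lt : ∀ i, κ i < K
  step : ∀ k < K, w (k + 1) = w k + η • ∑ i, (if κ i = k then lossSlope ⟪w k, z i⟫ else 0) • z i

variable {z : ι → E} {σ γ η : ℝ} {K : ℕ} {κ : ι → ℕ} {w : ℕ → E}

lemma IsEpoch.iterate_eq (h : IsEpoch z η K κ w) {k : ℕ} (hk : k ≤ K) :
    w k = w 0 + η • ∑ i, (if κ i < k then lossSlope ⟪w (κ i), z i⟫ else 0) • z i := by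
  induction k with
  | zero => simp
  | succ k ih =>
    rw [h.step k hk, ih (by omega), add_assoc, ← smul_add, ← Finset.sum_add_distrib,
      ← ih (by omega)]
    congr 2
    refine Finset.sum_congr rfl fun i _ => ?_
    rw [← add_smul]
    congr 1
    rcases lt_trichotomy (κ i) k with hi | hi | hi
    · simp [hi, hi.ne, Nat.lt_succ_of_lt hi]
    · simp [hi]
    · simp [hi.ne', not_lt.2 hi.le, not_lt.2 (Nat.succ_le_of_lt hi)]

lemma IsEpoch.last_eq (h : IsEpoch z η K κ w) :
    w K = w 0 + η • ∑ i, lossSlope ⟪w (κ i), z i⟫ • z i := by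
  rw [h.iterate_eq le_rfl]
  simp [h.lt]

lemma IsEpoch.norm_sub_sq_le (h : IsEpoch z η K κ w) (ha : IsAdmissible z σ γ η K)
    {k : ℕ} (hk : k ≤ K) :
    ‖w k - w 0‖ ^ 2 ≤ η ^ 2 * σ ^ 2 * ∑ i, lossSlope ⟪w (κ i), z i⟫ ^ 2 := by
  rw [h.iterate_eq hk, add_sub_cancel_left, norm_smul, mul_pow, Real.norm_eq_abs, sq_abs, mul_assoc]
  refine mul_le_mul_of_nonneg_left ((ha.norm_sq_le _).trans ?_) (sq_nonneg η)
  refine mul_le_mul_of_nonneg_left (Finset.sum_le_sum fun i _ => ?_) (sq_nonneg σ)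
  split_ifs
  · exact le_rfl
  · simp [sq_nonneg]

/-- Different examples see different iterates, so each squared deviation is bounded by its sum over
all `K` iterates; this is the source of the factor `K`, and it allows the operator bound to be
applied iterate by iterate. -/
lemma IsEpoch.sum_sq_sub_le_online (h : IsEpoch z η K κ w) (ha : IsAdmissible z σ γ η K) :
    ∑ i, (lossSlope ⟪w (κ i), z i⟫ - lossSlope ⟪w 0, z i⟫) ^ 2 ≤
      (η * σ ^ 2 / 4) ^ 2 * K * ∑ i, lossSlope ⟪w (κ i), z i⟫ ^ 2 := by
  calc ∑ i, (lossSlope ⟪w (κ i), z i⟫ - lossSlope ⟪w 0, z i⟫) ^ 2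
      ≤ ∑ i, (1 / 4) ^ 2 * ⟪w (κ i) - w 0, z i⟫ ^ 2 := by
        refine Finset.sum_le_sum fun i _ => ?_
        rw [← mul_pow, sq_le_sq, abs_mul, inner_sub_left, abs_of_pos (by norm_num : (0 : ℝ) < 1 / 4)]
        exact lossSlope_lipschitz _ _
    _ ≤ ∑ i, (1 / 4) ^ 2 * ∑ k ∈ Finset.range K, ⟪w k - w 0, z i⟫ ^ 2 := by
        gcongr with i
        exact Finset.single_le_sum (f := fun k => ⟪w k - w 0, z i⟫ ^ 2)
          (fun k _ => sq_nonneg _) (Finset.mem_range.2 (h.lt i))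
    _ = (1 / 4) ^ 2 * ∑ k ∈ Finset.range K, ∑ i, ⟪w k - w 0, z i⟫ ^ 2 := by
        rw [← Finset.mul_sum, Finset.sum_comm]
    _ ≤ (1 / 4) ^ 2 * ∑ k ∈ Finset.range K,
          σ ^ 2 * (η ^ 2 * σ ^ 2 * ∑ i, lossSlope ⟪w (κ i), z i⟫ ^ 2) := by
        gcongr with k hk
        refine (ha.sum_inner_sq_le _).trans ?_
        gcongr
        exact h.norm_sub_sq_le ha (Finset.mem_range.1 hk).le
    _ = _ := by
        rw [Finset.sum_const, Finset.card_range, nsmul_eq_mul]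
        ring

lemma IsAdmissible.contraction_le (ha : IsAdmissible z σ γ η K) :
    (η * σ ^ 2 / 4) ^ 2 * K ≤ 1 / 16 := by
  have h1 := ha.sq_mul_le
  have h2 := ha.gamma_pos
  have h3 : γ ^ 2 ≤ σ ^ 2 := by have := ha.gamma_le_sigma; gcongr
  have h4 : 0 < σ ^ 2 := lt_of_lt_of_le (by positivity) h3
  nlinarith

lemma sum_sq_le_two_mul_add (a b : ι → ℝ) :
    ∑ i, b i ^ 2 ≤ 2 * ∑ i, a i ^ 2 + 2 * ∑ i, (b i - a i) ^ 2 := by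
  rw [Finset.mul_sum, Finset.mul_sum, ← Finset.sum_add_distrib]
  exact Finset.sum_le_sum fun i _ => by nlinarith [sq_nonneg (a i - (b i - a i))]

/-- The online slopes are at most the initial ones plus the deviation. With contraction factor at
most `1/16` the deviation is absorbed on the left: `1 - 2/16 = 7/8` and `2 / (7/8) = 16/7`. -/
lemma IsEpoch.sum_sq_sub_le (h : IsEpoch z η K κ w) (ha : IsAdmissible z σ γ η K) :
    ∑ i, (lossSlope ⟪w (κ i), z i⟫ - lossSlope ⟪w 0, z i⟫) ^ 2 ≤
      16 / 7 * ((η * σ ^ 2 / 4) ^ 2 * K) * ∑ i, lossSlope ⟪w 0, z i⟫ ^ 2 := by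
  have h1 := h.sum_sq_sub_le_online ha
  have h2 := sum_sq_le_two_mul_add (fun i => lossSlope ⟪w 0, z i⟫) (fun i => lossSlope ⟪w (κ i), z i⟫)
  have h3 := ha.contraction_le
  have h4 : 0 ≤ (η * σ ^ 2 / 4) ^ 2 * K := by positivity
  have h5 : 0 ≤ ∑ i, (lossSlope ⟪w (κ i), z i⟫ - lossSlope ⟪w 0, z i⟫) ^ 2 :=
    Finset.sum_nonneg fun i _ => sq_nonneg _
  have h6 := mul_le_mul_of_nonneg_left h2 h4
  have h7 := mul_le_mul_of_nonneg_right h3 h5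
  linarith

lemma IsEpoch.sum_online_sq_le (h : IsEpoch z η K κ w) (ha : IsAdmissible z σ γ η K) :
    ∑ i, lossSlope ⟪w (κ i), z i⟫ ^ 2 ≤ 3 * ∑ i, lossSlope ⟪w 0, z i⟫ ^ 2 := by
  have h1 := h.sum_sq_sub_le ha
  have h2 := sum_sq_le_two_mul_add
    (fun i => lossSlope ⟪w 0, z i⟫) (fun i => lossSlope ⟪w (κ i), z i⟫)
  have h3 := ha.contraction_le
  have h5 : 0 ≤ ∑ i, lossSlope ⟪w 0, z i⟫ ^ 2 := Finset.sum_nonneg fun i _ => sq_nonneg _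
  have h7 := mul_le_mul_of_nonneg_right h3 h5
  linarith

lemma IsAdmissible.sq_mul_sum_sq_le (ha : IsAdmissible z σ γ η K) {v : ι → ℝ}
    (hv : ∀ i, 0 ≤ v i) : γ ^ 2 * ∑ i, v i ^ 2 ≤ ‖∑ i, v i • z i‖ ^ 2 := by
  have h0 := ha.gamma_pos
  have h1 := Finset.sum_sq_le_sq_sum_of_nonneg (s := Finset.univ) (fun i _ => hv i)
  have h2 : 0 ≤ ∑ i, v i := Finset.sum_nonneg fun i _ => hv i
  calc γ ^ 2 * ∑ i, v i ^ 2 ≤ γ ^ 2 * (∑ i, v i) ^ 2 := by gcongr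
    _ = (γ * ∑ i, v i) ^ 2 := by ring
    _ ≤ _ := by
      have := ha.mul_sum_le v
      gcongr

lemma IsEpoch.norm_error_sq_le (h : IsEpoch z η K κ w) (ha : IsAdmissible z σ γ η K) :
    ‖∑ i, (lossSlope ⟪w (κ i), z i⟫ - lossSlope ⟪w 0, z i⟫) • z i‖ ^ 2 ≤
      1 / 7 * ‖∑ i, lossSlope ⟪w 0, z i⟫ • z i‖ ^ 2 := by
  have h1 := ha.norm_sq_le fun i => lossSlope ⟪w (κ i), z i⟫ - lossSlope ⟪w 0, z i⟫
  have h2 := mul_le_mul_of_nonneg_left (h.sum_sq_sub_le ha) (sq_nonneg σ)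
  have h3 := ha.sq_mul_sum_sq_le (v := fun i => lossSlope ⟪w 0, z i⟫)
    fun i => (lossSlope_pos _).le
  have h4 : 0 ≤ ∑ i, lossSlope ⟪w 0, z i⟫ ^ 2 := Finset.sum_nonneg fun i _ => sq_nonneg _
  have h5 := mul_le_mul_of_nonneg_right ha.sq_mul_le h4
  linarith

/-- The training loss of the linear model `w` on the signed examples `z`. -/
noncomputable def totalLoss (z : ι → E) (w : E) : ℝ := ∑ i, logisticLoss ⟪w, z i⟫

lemma totalLoss_add_le (ha : IsAdmissible z σ γ η K) (w v : E) :
    totalLoss z (w + v) ≤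
      totalLoss z w - ⟪∑ i, lossSlope ⟪w, z i⟫ • z i, v⟫ + σ ^ 2 / 8 * ‖v‖ ^ 2 := by
  have h1 : totalLoss z (w + v) ≤ ∑ i, (logisticLoss ⟪w, z i⟫
      - lossSlope ⟪w, z i⟫ * ⟪z i, v⟫ + ⟪v, z i⟫ ^ 2 / 8) := by
    refine Finset.sum_le_sum fun i _ => ?_
    have := logisticLoss_le_quadratic ⟪w, z i⟫ ⟪w + v, z i⟫
    rw [real_inner_comm v (z i)]
    rwa [inner_add_left, add_sub_cancel_left, ← inner_add_left] at this

  rw [Finset.sum_add_distrib, Finset.sum_sub_distrib, ← Finset.sum_div] at h1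
  have h2 := ha.sum_inner_sq_le v
  have h3 : ⟪∑ i, lossSlope ⟪w, z i⟫ • z i, v⟫ = ∑ i, lossSlope ⟪w, z i⟫ * ⟪z i, v⟫ := by
    simp_rw [sum_inner, real_inner_smul_left]
  rw [h3]
  unfold totalLoss at *
  linarith

/-- In units of `η`, the coefficient of `‖g‖²` is `-1 + 1/2 + 1/4` and that of `‖r‖²` is `1/2 +
1/4`; with `‖r‖² ≤ ‖g‖²/7` they add up to `-1/7`. -/
lemma IsEpoch.totalLoss_le (h : IsEpoch z η K κ w) (ha : IsAdmissible z σ γ η K) :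
    totalLoss z (w K) ≤
      totalLoss z (w 0) - η / 7 * ‖∑ i, lossSlope ⟪w 0, z i⟫ • z i‖ ^ 2 := by
  set g := ∑ i, lossSlope ⟪w 0, z i⟫ • z i with hg
  set r := ∑ i, (lossSlope ⟪w (κ i), z i⟫ - lossSlope ⟪w 0, z i⟫) • z i with hr
  have hr2 : ‖r‖ ^ 2 ≤ 1 / 7 * ‖g‖ ^ 2 := h.norm_error_sq_le ha
  have hw : w K = w 0 + η • (g + r) := by
    rw [h.last_eq, hg, hr, ← Finset.sum_add_distrib]
    simp_rw [← add_smul, add_sub_cancel]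
  have h1 := totalLoss_add_le ha (w 0) (η • (g + r))
  rw [← hw, ← hg, real_inner_smul_right, inner_add_right, real_inner_self_eq_norm_sq, norm_smul,
    mul_pow, Real.norm_eq_abs, sq_abs] at h1
  have h2 : ‖g + r‖ ^ 2 ≤ 2 * ‖g‖ ^ 2 + 2 * ‖r‖ ^ 2 := by
    have := parallelogram_law_with_norm ℝ g r
    nlinarith [sq_nonneg ‖g - r‖]
  have h3 : -⟪g, r⟫ ≤ ‖g‖ ^ 2 / 2 + ‖r‖ ^ 2 / 2 := by
    have := abs_real_inner_le_norm g r
    nlinarith [neg_abs_le ⟪g, r⟫, sq_nonneg (‖g‖ - ‖r‖)]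
  have h0 := ha.eta_pos
  have h4 : σ ^ 2 / 8 * (η ^ 2 * ‖g + r‖ ^ 2) ≤ η / 8 * ‖g + r‖ ^ 2 := by
    have := mul_le_mul_of_nonneg_left ha.eta_mul_sq_le
      (show 0 ≤ η / 8 * ‖g + r‖ ^ 2 by positivity)
    linarith
  have h5 : 0 ≤ ‖g‖ ^ 2 := sq_nonneg _
  nlinarith

end Epoch

/-! ### Decay rates along the whole trajectory. -/

section Trajectory

variable {ι : Type*} [Fintype ι] {E : Type*} [NormedAddCommGroup E] [InnerProductSpace ℝ E]
  {z : ι → E} {σ γ η : ℝ} {K : ℕ} {κ : ℕ → ι → ℕ} {w : ℕ → E}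

lemma logisticLoss_le_totalLoss (z : ι → E) (w : E) (i : ι) :
    logisticLoss ⟪w, z i⟫ ≤ totalLoss z w :=
  Finset.single_le_sum (f := fun i => logisticLoss ⟪w, z i⟫)
    (fun _ _ => (logisticLoss_pos _).le) (Finset.mem_univ i)

lemma totalLoss_pos [Nonempty ι] (z : ι → E) (w : E) : 0 < totalLoss z w :=
  Finset.sum_pos (fun _ _ => logisticLoss_pos _) Finset.univ_nonempty

lemma epoch_last_eq {F : Type*} (w : ℕ → F) (K e : ℕ) : w (e * K + K) = w ((e + 1) * K) := by
  rw [Nat.succ_mul]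

lemma totalLoss_antitone (ha : IsAdmissible z σ γ η K)
    (h : ∀ e, IsEpoch z η K (κ e) (fun k => w (e * K + k))) :
    Antitone fun e => totalLoss z (w (e * K)) := by
  refine antitone_nat_of_succ_le fun e => ?_
  have h1 := (h e).totalLoss_le ha
  simp only [add_zero, epoch_last_eq] at h1
  have := ha.eta_pos
  have : 0 ≤ η / 7 * ‖∑ i, lossSlope ⟪w (e * K), z i⟫ • z i‖ ^ 2 := by positivity
  linarith

lemma exists_exp_neg_le [Nonempty ι] (ha : IsAdmissible z σ γ η K)
    (h : ∀ e, IsEpoch z η K (κ e) (fun k => w (e * K + k))) :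
    ∃ C, 0 ≤ C ∧ ∀ e : ℕ, 1 ≤ e → ∀ i, Real.exp (-⟪w (e * K), z i⟫) ≤ C / e := by
  set L : ℕ → ℝ := fun e => totalLoss z (w (e * K)) with hL
  have hpos : ∀ e, 0 < L e := fun e => totalLoss_pos _ _
  have hanti : Antitone L := totalLoss_antitone ha h
  have hη := ha.eta_pos
  have hγ := ha.gamma_pos
  -- Each example loss is at most `L 0`, so `L e ≤ (1 + L 0) ∑ s`, while the gradient norm is at
  -- least `γ ∑ s`.
  set c := η / 7 * (γ / (1 + L 0)) ^ 2 with hc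
  have h0 := hpos 0
  have hc0 : 0 < c := by positivity
  have hstep : ∀ e, L (e + 1) ≤ L e - c * L e ^ 2 := by
    intro e
    have h1 := (h e).totalLoss_le ha
    simp only [add_zero, epoch_last_eq] at h1
    have h2 : L e ≤ (1 + L 0) * ∑ i, lossSlope ⟪w (e * K), z i⟫ := by
      change totalLoss z _ ≤ _
      rw [totalLoss, Finset.mul_sum]
      refine Finset.sum_le_sum fun i _ => (logisticLoss_le_lossSlope _).trans ?_
      refine mul_le_mul_of_nonneg_right ?_ (lossSlope_pos _).le
      linarith [logisticLoss_le_totalLoss z (w (e * K)) i, hanti (Nat.zero_le e)]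
    have h3 : γ / (1 + L 0) * L e ≤ ‖∑ i, lossSlope ⟪w (e * K), z i⟫ • z i‖ := by
      refine le_trans ?_ (ha.mul_sum_le _)
      rw [div_mul_eq_mul_div, div_le_iff₀ (by positivity), mul_assoc]
      rw [mul_comm] at h2
      gcongr
    have h4 : (γ / (1 + L 0) * L e) ^ 2 ≤ ‖∑ i, lossSlope ⟪w (e * K), z i⟫ • z i‖ ^ 2 := by
      have := hpos e
      gcongr
    have h5 := mul_le_mul_of_nonneg_left h4 (show 0 ≤ η / 7 by positivity)
    have h6 : c * L e ^ 2 = η / 7 * (γ / (1 + L 0) * L e) ^ 2 := by rw [hc]; ring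
    rw [h6]
    exact h1.trans (by linarith)
  refine ⟨Real.exp (L 0) / c, by positivity, fun e he i => ?_⟩
  have he' : (0 : ℝ) < e := by exact_mod_cast he
  have h1 : L e ≤ 1 / (c * e) := by
    rw [le_div_iff₀ (by positivity)]
    exact le_div_of_le_sub_sq hc0 hpos hstep e
  have h2 : logisticLoss ⟪w (e * K), z i⟫ ≤ L e := logisticLoss_le_totalLoss z _ i
  calc Real.exp (-⟪w (e * K), z i⟫)
      ≤ logisticLoss ⟪w (e * K), z i⟫ * Real.exp (logisticLoss ⟪w (e * K), z i⟫) :=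
        exp_neg_le_logisticLoss _
    _ ≤ 1 / (c * e) * Real.exp (L 0) :=
        mul_le_mul (h2.trans h1) (Real.exp_le_exp.2 (h2.trans (hanti (Nat.zero_le e))))
          (Real.exp_pos _).le (by positivity)
    _ = Real.exp (L 0) / c / e := by field_simp

lemma exists_norm_sub_le [Nonempty ι] (ha : IsAdmissible z σ γ η K)
    (h : ∀ e, IsEpoch z η K (κ e) (fun k => w (e * K + k))) :
    ∃ C, 0 ≤ C ∧ ∀ e : ℕ, 1 ≤ e → ∀ k ≤ K, ‖w (e * K + k) - w (e * K)‖ ≤ C / e := by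
  obtain ⟨C, hC, hexp⟩ := exists_exp_neg_le ha h
  have hη := ha.eta_pos
  have hσ := ha.gamma_pos.trans_le ha.gamma_le_sigma
  refine ⟨√(3 * Fintype.card ι) * (η * σ * C), by positivity, fun e he k hk => ?_⟩
  have h1 := (h e).norm_sub_sq_le ha hk
  have h2 := (h e).sum_online_sq_le ha
  simp only [add_zero] at h1 h2
  have h3 : ∑ i, lossSlope ⟪w (e * K), z i⟫ ^ 2 ≤ Fintype.card ι * (C / e) ^ 2 := by
    rw [← nsmul_eq_mul]
    refine Finset.sum_le_card_nsmul _ _ _ fun i _ => ?_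
    have := (lossSlope_le_exp _).trans (hexp e he i)
    have := (lossSlope_pos ⟪w (e * K), z i⟫).le
    gcongr
  have h4 : ‖w (e * K + k) - w (e * K)‖ ^ 2 ≤
      (√(3 * Fintype.card ι) * (η * σ * C) / e) ^ 2 := by
    refine h1.trans ((mul_le_mul_of_nonneg_left (h2.trans
      (mul_le_mul_of_nonneg_left h3 (by norm_num))) (by positivity)).trans_eq ?_)
    rw [mul_div_assoc, mul_pow (√_), Real.sq_sqrt (by positivity)]
    ring
  exact le_of_sq_le_sq h4 (by positivity)

lemma IsAdmissible.abs_inner_le (ha : IsAdmissible z σ γ η K) (v : E) (i : ι) :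
    |⟪v, z i⟫| ≤ σ * ‖v‖ := by
  have hσ := ha.gamma_pos.trans_le ha.gamma_le_sigma
  refine abs_le_of_sq_le_sq ?_ (by positivity)
  rw [mul_pow]
  exact (Finset.single_le_sum (f := fun i => ⟪v, z i⟫ ^ 2)
    (fun i _ => sq_nonneg _) (Finset.mem_univ i)).trans (ha.sum_inner_sq_le v)

lemma exp_sub_one_le_mul_exp (x : ℝ) : Real.exp x - 1 ≤ x * Real.exp x := by
  have h1 := Real.add_one_le_exp (-x)
  have h2 : Real.exp (-x) * Real.exp x = 1 := by rw [← Real.exp_add]; simp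
  nlinarith [mul_le_mul_of_nonneg_right h1 (Real.exp_pos x).le]

/-- Both errors are second order: the slope is `O(1/e)` and its relative change under a drift of
order `1/e` is `O(1/e)`, while replacing the slope by the exponential costs `exp(-2m)`. -/
lemma exists_online_slope_sub_exp_le [Nonempty ι] (ha : IsAdmissible z σ γ η K)
    (h : ∀ e, IsEpoch z η K (κ e) (fun k => w (e * K + k))) :
    ∃ C, 0 ≤ C ∧ ∀ e : ℕ, 1 ≤ e → ∀ i,
      |lossSlope ⟪w (e * K + κ e i), z i⟫ - Real.exp (-⟪w (e * K), z i⟫)| ≤ C / (e : ℝ) ^ 2 := by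
  obtain ⟨C, hC, hexp⟩ := exists_exp_neg_le ha h
  obtain ⟨D, hD, hnorm⟩ := exists_norm_sub_le ha h
  have hσ := ha.gamma_pos.trans_le ha.gamma_le_sigma
  refine ⟨C * (σ * D * Real.exp (σ * D)) + C ^ 2, by positivity, fun e he i => ?_⟩
  have he' : (1 : ℝ) ≤ e := by exact_mod_cast he
  set m := ⟪w (e * K), z i⟫ with hm
  set m' := ⟪w (e * K + κ e i), z i⟫ with hm'
  have hx : |m' - m| ≤ σ * D / e := by
    rw [hm, hm', ← inner_sub_left, mul_div_assoc]
    refine (ha.abs_inner_le _ i).trans ?_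
    gcongr
    exact hnorm e he _ ((h e).lt i).le
  have h1 : Real.exp |m' - m| - 1 ≤ σ * D / e * Real.exp (σ * D) := by
    refine (exp_sub_one_le_mul_exp _).trans ?_
    gcongr
    exact hx.trans (div_le_self (by positivity) he')
  have h2 : lossSlope m ≤ C / e := (lossSlope_le_exp m).trans (hexp e he i)
  have h3 : |lossSlope m' - lossSlope m| ≤ C / e * (σ * D / e * Real.exp (σ * D)) :=
    (abs_lossSlope_sub_le m m').trans (mul_le_mul h2 h1
      (sub_nonneg.2 (Real.one_le_exp (abs_nonneg _))) (by positivity))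
  have h4 : |lossSlope m - Real.exp (-m)| ≤ (C / e) ^ 2 := by
    refine (exp_neg_sub_lossSlope m).trans ?_
    have := hexp e he i
    gcongr
  calc |lossSlope m' - Real.exp (-m)|
      ≤ |lossSlope m' - lossSlope m| + |lossSlope m - Real.exp (-m)| := abs_sub_le _ _ _
    _ ≤ C / e * (σ * D / e * Real.exp (σ * D)) + (C / e) ^ 2 := add_le_add h3 h4
    _ = _ := by field_simp

/-! ### Convergence of the residual. -/

variable {α : ι → ℝ} {u : E}

/-- The deviation of the iterate at the start of epoch `e` from its predicted position. -/
noncomputable def residual (z : ι → E) (α : ι → ℝ) (u : E) (K : ℕ) (w : ℕ → E) (e : ℕ) : E :=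
  w (e * K) - Real.log e • ∑ i, α i • z i - u

lemma residual_succ (h : ∀ e, IsEpoch z η K (κ e) (fun k => w (e * K + k))) (e : ℕ) :
    residual z α u K w (e + 1) = residual z α u K w e +
      ∑ i, (η * lossSlope ⟪w (e * K + κ e i), z i⟫
        - α i * (Real.log ((e : ℝ) + 1) - Real.log e)) • z i := by
  have h1 := (h e).last_eq
  simp only [add_zero, epoch_last_eq] at h1
  have h2 : ∑ i, (η * lossSlope ⟪w (e * K + κ e i), z i⟫
        - α i * (Real.log ((e : ℝ) + 1) - Real.log e)) • z i =
      η • ∑ i, lossSlope ⟪w (e * K + κ e i), z i⟫ • z i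
        - (Real.log ((e : ℝ) + 1) - Real.log e) • ∑ i, α i • z i := by
    rw [Finset.smul_sum, Finset.smul_sum, ← Finset.sum_sub_distrib]
    refine Finset.sum_congr rfl fun i _ => ?_
    rw [sub_smul, smul_smul, smul_smul, mul_comm (α i)]
  unfold residual
  rw [h1, h2, sub_smul, Nat.cast_succ]
  abel

lemma exp_neg_inner_eq (hη : 0 < η)
    (hhat : ∀ i, ⟪∑ j, α j • z j, z i⟫ = 1) (hu : ∀ i, Real.exp (-⟪u, z i⟫) = α i / η)
    {e : ℕ} (he : 1 ≤ e) (i : ι) :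
    η * Real.exp (-⟪w (e * K), z i⟫) = α i / e * Real.exp (-⟪residual z α u K w e, z i⟫) := by
  have he' : (0 : ℝ) < e := by exact_mod_cast he
  have h1 : -⟪w (e * K), z i⟫ =
      -⟪residual z α u K w e, z i⟫ + -⟪u, z i⟫ + -Real.log e := by
    unfold residual
    rw [inner_sub_left, inner_sub_left, real_inner_smul_left, hhat]
    ring
  rw [h1, Real.exp_add, Real.exp_add, hu, Real.exp_neg (Real.log e), Real.exp_log he']
  field_simp

lemma exists_norm_residual_sq_le [Nonempty ι] (ha : IsAdmissible z σ γ η K)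
    (h : ∀ e, IsEpoch z η K (κ e) (fun k => w (e * K + k)))
    (hα : ∀ i, 0 < α i) (hhat : ∀ i, ⟪∑ j, α j • z j, z i⟫ = 1)
    (hu : ∀ i, Real.exp (-⟪u, z i⟫) = α i / η) :
    ∃ C, 0 ≤ C ∧ ∀ e : ℕ, 1 ≤ e →
      ‖residual z α u K w (e + 1)‖ ^ 2 ≤ ‖residual z α u K w e‖ ^ 2
        - 2 / e * ∑ i, α i * (⟪residual z α u K w e, z i⟫
            * (1 - Real.exp (-⟪residual z α u K w e, z i⟫)))
        + C / (e : ℝ) ^ 2 * (1 + ‖residual z α u K w e‖ ^ 2) := by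
  obtain ⟨C, hC, hexp⟩ := exists_exp_neg_le ha h
  obtain ⟨D, hD, hslope⟩ := exists_online_slope_sub_exp_le ha h
  have hη := ha.eta_pos
  have hσ := ha.gamma_pos.trans_le ha.gamma_le_sigma
  obtain ⟨A, hA0, hA⟩ : ∃ A : ℝ, 0 ≤ A ∧ ∀ i, α i ≤ A :=
    ⟨∑ i, α i, Finset.sum_nonneg fun i _ => (hα i).le,
      fun i => Finset.single_le_sum (fun j _ => (hα j).le) (Finset.mem_univ i)⟩
  set C₁ := η * D + A with hC₁
  set C₂ := C₁ + η * C + A with hC₂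
  set n : ℝ := (Fintype.card ι : ℝ) with hn
  have hC₁0 : 0 ≤ C₁ := by positivity
  have hC₂0 : 0 ≤ C₂ := by positivity
  have hn0 : 0 ≤ n := by positivity
  refine ⟨2 * C₁ * (n + σ ^ 2) + σ ^ 2 * (n * C₂ ^ 2), by positivity, fun e he => ?_⟩
  have he1 : (1 : ℝ) ≤ e := by exact_mod_cast he
  have he0 : (0 : ℝ) < e := by linarith
  set r := residual z α u K w e with hr
  set c : ι → ℝ := fun i => η * lossSlope ⟪w (e * K + κ e i), z i⟫
        - α i * (Real.log ((e : ℝ) + 1) - Real.log e) with hc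
  -- Leading part of the increment `c`; the difference collects the slope error and the gap between
  -- `1/e` and `log (e+1) - log e`.
  set f : ι → ℝ := fun i => α i / e * (Real.exp (-⟪r, z i⟫) - 1) with hf
  have hcf : ∀ i, |c i - f i| ≤ C₁ / (e : ℝ) ^ 2 := by
    intro i
    have h1 := hslope e he i
    have h2 := abs_inv_sub_log_le he0
    have h3 := exp_neg_inner_eq (w := w) (K := K) hη hhat hu he i
    rw [← hr] at h3
    have h4 : c i - f i = η * (lossSlope ⟪w (e * K + κ e i), z i⟫ - Real.exp (-⟪w (e * K), z i⟫))
        + α i * (1 / e - (Real.log ((e : ℝ) + 1) - Real.log e)) := by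
      simp only [hc, hf]
      rw [mul_sub (α i / e), ← h3]
      ring
    rw [h4]
    refine (abs_add_le _ _).trans ?_
    rw [abs_mul, abs_mul, abs_of_pos hη, abs_of_pos (hα i)]
    calc _ ≤ η * (D / (e : ℝ) ^ 2) + A * (1 / (e : ℝ) ^ 2) :=
          add_le_add (mul_le_mul_of_nonneg_left h1 hη.le)
            (mul_le_mul (hA i) h2 (abs_nonneg _) hA0)
      _ = _ := by rw [hC₁]; ring
  have hfb : ∀ i, |f i| ≤ (η * C + A) / e := by
    intro i
    have h3 := exp_neg_inner_eq (w := w) (K := K) hη hhat hu he i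
    rw [← hr] at h3
    have h4 : f i = η * Real.exp (-⟪w (e * K), z i⟫) - α i / e := by
      simp only [hf]
      rw [h3]
      ring
    have h5 : η * Real.exp (-⟪w (e * K), z i⟫) ≤ η * (C / e) :=
      mul_le_mul_of_nonneg_left (hexp e he i) hη.le
    have h6 : 0 ≤ η * Real.exp (-⟪w (e * K), z i⟫) := by positivity
    have h7 : α i / e ≤ A / e := div_le_div_of_nonneg_right (hA i) he0.le
    have h8 : 0 ≤ α i / e := div_nonneg (hα i).le he0.le
    have h9 : (η * C + A) / e = η * (C / e) + A / e := by ring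
    rw [h4, h9, abs_le]
    constructor <;> linarith
  have hcb : ∀ i, c i ^ 2 ≤ (C₂ / e) ^ 2 := by
    intro i
    refine sq_le_sq' ?_ ?_ <;>
    · have h1 := abs_le.1 (hcf i)
      have h2 := abs_le.1 (hfb i)
      have h3 : C₁ / (e : ℝ) ^ 2 ≤ C₁ / e :=
        div_le_div_of_nonneg_left hC₁0 he0 (by nlinarith)
      have h4 : C₂ / (e : ℝ) = C₁ / e + (η * C + A) / e := by rw [hC₂]; ring
      linarith [h1.1, h1.2, h2.1, h2.2]
  have hΔ : ‖∑ i, c i • z i‖ ^ 2 ≤ σ ^ 2 * (n * (C₂ / e) ^ 2) := by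
    refine (ha.norm_sq_le c).trans ?_
    gcongr
    rw [hn, ← nsmul_eq_mul]
    exact Finset.sum_le_card_nsmul _ _ _ fun i _ => hcb i
  have hin : ⟪r, ∑ i, c i • z i⟫ = ∑ i, f i * ⟪r, z i⟫ + ∑ i, (c i - f i) * ⟪r, z i⟫ := by
    rw [inner_sum, ← Finset.sum_add_distrib]
    refine Finset.sum_congr rfl fun i _ => ?_
    rw [real_inner_smul_right]
    ring
  have hmain : ∑ i, f i * ⟪r, z i⟫ =
      -(1 / e * ∑ i, α i * (⟪r, z i⟫ * (1 - Real.exp (-⟪r, z i⟫)))) := by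
    rw [Finset.mul_sum, ← Finset.sum_neg_distrib]
    refine Finset.sum_congr rfl fun i _ => ?_
    simp only [hf]
    ring
  have herr : ∑ i, (c i - f i) * ⟪r, z i⟫ ≤ C₁ / (e : ℝ) ^ 2 * (n + σ ^ 2 * ‖r‖ ^ 2) := by
    calc ∑ i, (c i - f i) * ⟪r, z i⟫ ≤ ∑ i, C₁ / (e : ℝ) ^ 2 * (1 + ⟪r, z i⟫ ^ 2) := by
          refine Finset.sum_le_sum fun i _ => (le_abs_self _).trans ?_
          rw [abs_mul]
          refine mul_le_mul (hcf i) ?_ (abs_nonneg _) (by positivity)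
          nlinarith [sq_abs ⟪r, z i⟫, sq_nonneg (|⟪r, z i⟫| - 1), abs_nonneg ⟪r, z i⟫]
      _ = C₁ / (e : ℝ) ^ 2 * (n + ∑ i, ⟪r, z i⟫ ^ 2) := by
          rw [← Finset.mul_sum, Finset.sum_add_distrib]
          simp [hn]
      _ ≤ _ := by
          have := ha.sum_inner_sq_le r
          gcongr
  rw [residual_succ h, ← hr, norm_add_sq_real, hin, hmain]
  set φ := ∑ i, α i * (⟪r, z i⟫ * (1 - Real.exp (-⟪r, z i⟫)))
  have e1 : 2 / (e : ℝ) * φ = 2 * (1 / e * φ) := by ring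
  have e2 : C₁ / (e : ℝ) ^ 2 * (n + σ ^ 2 * ‖r‖ ^ 2) ≤
      C₁ / (e : ℝ) ^ 2 * ((n + σ ^ 2) * (1 + ‖r‖ ^ 2)) := by
    gcongr
    nlinarith [mul_nonneg hn0 (sq_nonneg ‖r‖), sq_nonneg σ]
  have e3 : σ ^ 2 * (n * (C₂ / e) ^ 2) ≤ σ ^ 2 * (n * (C₂ / e) ^ 2) * (1 + ‖r‖ ^ 2) :=
    le_mul_of_one_le_right (by positivity) (by nlinarith [sq_nonneg ‖r‖])
  have e4 : (2 * C₁ * (n + σ ^ 2) + σ ^ 2 * (n * C₂ ^ 2)) / (e : ℝ) ^ 2 * (1 + ‖r‖ ^ 2) =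
      2 * (C₁ / (e : ℝ) ^ 2 * ((n + σ ^ 2) * (1 + ‖r‖ ^ 2)))
        + σ ^ 2 * (n * (C₂ / e) ^ 2) * (1 + ‖r‖ ^ 2) := by
    field_simp
  rw [e4]
  change _ + 2 * _ + ‖∑ i, c i • z i‖ ^ 2 ≤ _
  linarith

lemma tendsto_residual [Nonempty ι] (ha : IsAdmissible z σ γ η K)
    (h : ∀ e, IsEpoch z η K (κ e) (fun k => w (e * K + k)))
    (hα : ∀ i, 0 < α i) (hhat : ∀ i, ⟪∑ j, α j • z j, z i⟫ = 1)
    (hu : ∀ i, Real.exp (-⟪u, z i⟫) = α i / η) {M : ℝ}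
    (hM : ∀ e, ‖residual z α u K w e‖ ^ 2 ≤ M * ∑ i, ⟪residual z α u K w e, z i⟫ ^ 2) :
    Tendsto (residual z α u K w) atTop (𝓝 0) := by
  obtain ⟨C, hC, hrec⟩ := exists_norm_residual_sq_le ha h hα hhat hu
  have hσ := ha.gamma_pos.trans_le ha.gamma_le_sigma
  set V : ℕ → ℝ := fun e => ‖residual z α u K w e‖ ^ 2 with hV
  have hV0 : ∀ e, 0 ≤ V e := fun e => sq_nonneg _
  have hterm : ∀ p : ℝ, 0 ≤ p * (1 - Real.exp (-p)) := fun p =>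
    le_trans (by positivity) (mul_one_sub_exp_neg_ge p)
  -- Boundedness comes first, from the mere sign of the dissipation; it confines the `⟪r, z i⟫` to a
  -- range where the dissipation is quadratically coercive.
  obtain ⟨B, hB⟩ := exists_bound_of_le_one_add (V := V) hC hV0 fun e he => by
    have h1 := hrec e he
    have h2 : 0 ≤ 2 / (e : ℝ) * ∑ i, α i * (⟪residual z α u K w e, z i⟫
            * (1 - Real.exp (-⟪residual z α u K w e, z i⟫))) :=
      mul_nonneg (by positivity)
        (Finset.sum_nonneg fun i _ => mul_nonneg (hα i).le (hterm _))
    simp only [hV]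
    linarith
  have hB0 : 0 ≤ B := (hV0 1).trans (hB 1 le_rfl)
  obtain ⟨i₀, hi₀⟩ := Finite.exists_min α
  set b := σ * √B with hb
  have hb0 : 0 ≤ b := by positivity
  set M' := max M 1 with hM'
  have hM'0 : 0 < M' := by positivity
  have hlim : Tendsto V atTop (𝓝 0) := by
    refine tendsto_zero_of_le_sub_div (c := 2 * (α i₀ / (1 + b) / M')) (C := C * (1 + B)) ?_
      (by positivity) hV0 fun e he => ?_
    · have := hα i₀
      positivity
    have he0 : (0 : ℝ) < e := by exact_mod_cast he
    have h1 := hrec e he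
    set r := residual z α u K w e with hr
    have h2 : ∀ i, α i₀ / (1 + b) * ⟪r, z i⟫ ^ 2 ≤
        α i * (⟪r, z i⟫ * (1 - Real.exp (-⟪r, z i⟫))) := by
      intro i
      have h3 : |⟪r, z i⟫| ≤ b := by
        refine (ha.abs_inner_le r i).trans ?_
        rw [hb]
        gcongr
        exact Real.le_sqrt_of_sq_le (hB e he)
      calc α i₀ / (1 + b) * ⟪r, z i⟫ ^ 2 = α i₀ * (⟪r, z i⟫ ^ 2 / (1 + b)) := by ring
        _ ≤ α i * (⟪r, z i⟫ ^ 2 / (1 + |⟪r, z i⟫|)) := by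
          have := hα i
          have := hi₀ i
          gcongr
        _ ≤ _ := mul_le_mul_of_nonneg_left (mul_one_sub_exp_neg_ge _) (hα i).le
    have h3 := Finset.sum_le_sum fun i (_ : i ∈ Finset.univ) => h2 i
    rw [← Finset.mul_sum] at h3
    have hS : 0 ≤ ∑ i, ⟪r, z i⟫ ^ 2 := Finset.sum_nonneg fun i _ => sq_nonneg _
    have h4 : V e ≤ M' * ∑ i, ⟪r, z i⟫ ^ 2 :=
      (hM e).trans (mul_le_mul_of_nonneg_right (le_max_left _ _) hS)
    have h5 : α i₀ / (1 + b) / M' * V e ≤ α i₀ / (1 + b) * ∑ i, ⟪r, z i⟫ ^ 2 := by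
      rw [div_mul_eq_mul_div, mul_div_assoc]
      have := hα i₀
      gcongr
      rwa [div_le_iff₀' hM'0]
    have h6 := mul_le_mul_of_nonneg_left (h5.trans h3) (show 0 ≤ 2 / (e : ℝ) by positivity)
    have h7 : C / (e : ℝ) ^ 2 * (1 + V e) ≤ C / (e : ℝ) ^ 2 * (1 + B) := by
      have := hB e he
      gcongr
    have h8 : 2 * (α i₀ / (1 + b) / M') / e * V e = 2 / e * (α i₀ / (1 + b) / M' * V e) := by ring
    have h9 : C * (1 + B) / (e : ℝ) ^ 2 = C / (e : ℝ) ^ 2 * (1 + B) := by ring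
    rw [h8, h9]
    change V (e + 1) ≤ V e - _ + C / (e : ℝ) ^ 2 * (1 + V e) at h1
    linarith
  rw [tendsto_zero_iff_norm_tendsto_zero]
  have := hlim.sqrt
  simpa [hV, Real.sqrt_sq (norm_nonneg _)] using this

/-- The deviation of the iterate at time `t` from its predicted position tends to zero. -/
lemma tendsto_norm_sub_log [Nonempty ι] (hK : 0 < K) (ha : IsAdmissible z σ γ η K)
    (h : ∀ e, IsEpoch z η K (κ e) (fun k => w (e * K + k)))
    (hα : ∀ i, 0 < α i) (hhat : ∀ i, ⟪∑ j, α j • z j, z i⟫ = 1)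
    (hu : ∀ i, Real.exp (-⟪u, z i⟫) = α i / η) {M : ℝ}
    (hM : ∀ e, ‖residual z α u K w e‖ ^ 2 ≤ M * ∑ i, ⟪residual z α u K w e, z i⟫ ^ 2) :
    Tendsto (fun t : ℕ => ‖w t - Real.log ((t : ℝ) / K) • ∑ i, α i • z i - u‖) atTop (𝓝 0) := by
  have hres := tendsto_residual ha h hα hhat hu hM
  obtain ⟨D, hD, hnorm⟩ := exists_norm_sub_le ha h
  have hdiv : Tendsto (fun t : ℕ => t / K) atTop atTop :=
    Nat.tendsto_div_const_atTop hK.ne'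
  set H := ‖∑ i, α i • z i‖
  -- With `e = ⌊t/K⌋`: the residual at the start of the epoch, the drift inside it, and the change
  -- from `log e` to `log (t/K)`.
  have hb : Tendsto (fun e : ℕ => ‖residual z α u K w e‖ + D / e + 1 / e * H) atTop (𝓝 0) := by
    have h1 := (tendsto_zero_iff_norm_tendsto_zero.1 hres).add
      (tendsto_const_div_atTop_nhds_zero_nat D)
    have h2 := (tendsto_const_div_atTop_nhds_zero_nat (1 : ℝ)).mul_const H
    simpa using h1.add h2
  refine squeeze_zero' (Eventually.of_forall fun t => norm_nonneg _) ?_ (hb.comp hdiv)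
  filter_upwards [hdiv.eventually_ge_atTop 1] with t ht
  simp only [Function.comp]
  have ht' : t / K * K + t % K = t := Nat.div_add_mod' t K
  have hmod := Nat.mod_lt t hK
  set e := t / K
  have he0 : (0 : ℝ) < e := by exact_mod_cast ht
  have hK0 : (0 : ℝ) < K := by exact_mod_cast hK
  have hle : (e : ℝ) ≤ t / K := by
    rw [le_div_iff₀ hK0]
    exact_mod_cast Nat.div_mul_le_self t K
  have hlt : (t : ℝ) / K ≤ e + 1 := by
    rw [div_le_iff₀ hK0]
    have : t ≤ (e + 1) * K := by rw [Nat.succ_mul]; omega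
    exact_mod_cast this
  have hlog : |Real.log e - Real.log ((t : ℝ) / K)| ≤ 1 / e := by
    have h1 : Real.log e ≤ Real.log ((t : ℝ) / K) := Real.log_le_log he0 hle
    have h2 : Real.log ((t : ℝ) / K) ≤ Real.log (e + 1) :=
      Real.log_le_log (he0.trans_le hle) hlt
    have h3 := Real.log_le_sub_one_of_pos (show 0 < ((e : ℝ) + 1) / e by positivity)
    rw [Real.log_div (by positivity) he0.ne', add_div, div_self he0.ne'] at h3
    rw [abs_sub_comm, abs_of_nonneg (by linarith)]
    linarith
  have hsplit : w t - Real.log ((t : ℝ) / K) • ∑ i, α i • z i - u =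
      residual z α u K w e + (w (e * K + t % K) - w (e * K))
        + (Real.log e - Real.log ((t : ℝ) / K)) • ∑ i, α i • z i := by
    rw [ht', residual, sub_smul]
    abel
  rw [hsplit]
  refine (norm_add₃_le).trans ?_
  rw [norm_smul, Real.norm_eq_abs]
  have := hnorm e ht (t % K) hmod.le
  gcongr

lemma tendsto_logisticLoss_mul_exp : Tendsto (fun m => logisticLoss m * Real.exp m) atTop (𝓝 1) := by
  have hlow : Tendsto (fun m : ℝ => (1 + Real.exp (-m))⁻¹) atTop (𝓝 1) := by
    have := (Real.tendsto_exp_neg_atTop_nhds_zero.const_add 1).inv₀ (by norm_num)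
    simpa using this
  refine tendsto_of_tendsto_of_tendsto_of_le_of_le hlow tendsto_const_nhds (fun m => ?_) fun m => ?_
  · have h1 := exp_neg_le_logisticLoss m
    rw [exp_logisticLoss] at h1
    have h2 : Real.exp (-m) * Real.exp m = 1 := by rw [← Real.exp_add]; simp
    rw [inv_le_iff_one_le_mul₀ (by positivity)]
    nlinarith [mul_le_mul_of_nonneg_right h1 (Real.exp_pos m).le]
  · have h2 : Real.exp (-m) * Real.exp m = 1 := by rw [← Real.exp_add]; simp
    exact (mul_le_mul_of_nonneg_right (logisticLoss_le_exp m) (Real.exp_pos m).le).trans_eq h2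

/-- Since the margins are `log (t/K) + ⟪u, z i⟫ + o(1)`, each loss times `t/K` tends to `α i / η`;
the factors `t/K` and `η` cancel in the quotient. -/
lemma tendsto_loss_share [Nonempty ι] (hK : 0 < K) (ha : IsAdmissible z σ γ η K)
    (hα : ∀ i, 0 < α i) (hhat : ∀ i, ⟪∑ j, α j • z j, z i⟫ = 1)
    (hu : ∀ i, Real.exp (-⟪u, z i⟫) = α i / η)
    (hw : Tendsto (fun t : ℕ => ‖w t - Real.log ((t : ℝ) / K) • ∑ i, α i • z i - u‖) atTop (𝓝 0))
    (i : ι) :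
    Tendsto (fun t => logisticLoss ⟪w t, z i⟫ / ∑ j, logisticLoss ⟪w t, z j⟫) atTop
      (𝓝 (α i / ∑ j, α j)) := by
  have hK0 : (0 : ℝ) < K := by exact_mod_cast hK
  have hη := ha.eta_pos
  have hmargin : ∀ i, Tendsto (fun t : ℕ => ⟪w t, z i⟫ - Real.log ((t : ℝ) / K)) atTop
      (𝓝 ⟪u, z i⟫) := by
    intro i
    have h1 := (tendsto_zero_iff_norm_tendsto_zero.2 hw).inner (𝕜 := ℝ) (tendsto_const_nhds (x := z i))
    have h2 := h1.add_const ⟪u, z i⟫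
    rw [inner_zero_left, zero_add] at h2
    refine h2.congr fun t => ?_
    rw [inner_sub_left, inner_sub_left, real_inner_smul_left, hhat]
    ring
  have htK : Tendsto (fun t : ℕ => (t : ℝ) / K) atTop atTop :=
    tendsto_natCast_atTop_atTop.atTop_div_const hK0
  have hscaled : ∀ i, Tendsto (fun t : ℕ => (t : ℝ) / K * logisticLoss ⟪w t, z i⟫) atTop
      (𝓝 (α i / η)) := by
    intro i
    have h1 : Tendsto (fun t => ⟪w t, z i⟫) atTop atTop := by
      have := (Real.tendsto_log_atTop.comp htK).atTop_add (hmargin i)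
      refine this.congr fun t => ?_
      simp
    have h2 := tendsto_logisticLoss_mul_exp.comp h1
    have h3 := (Real.continuous_exp.tendsto _).comp (hmargin i).neg
    have h4 := h2.mul h3
    rw [hu, one_mul] at h4
    refine h4.congr' ?_
    filter_upwards [eventually_gt_atTop 0] with t ht
    have ht0 : (0 : ℝ) < t := by exact_mod_cast ht
    simp only [Function.comp]
    rw [mul_assoc, ← Real.exp_add, mul_comm]
    congr 1
    rw [neg_sub, add_sub_cancel, Real.exp_log (by positivity)]
  have hsum := tendsto_finsetSum Finset.univ fun j _ => hscaled j
  have hne : ∑ j, α j / η ≠ 0 :=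
    (Finset.sum_pos (fun j _ => div_pos (hα j) hη) Finset.univ_nonempty).ne'
  have hquot := (hscaled i).div hsum hne
  rw [← Finset.sum_div, div_div_div_cancel_right₀ hη.ne'] at hquot
  refine hquot.congr' ?_
  filter_upwards [eventually_gt_atTop 0] with t ht
  have ht0 : (0 : ℝ) < t := by exact_mod_cast ht
  simp only [Pi.div_apply]
  rw [← Finset.mul_sum, mul_div_mul_left _ _ (by positivity)]

end Trajectory

/-! ### The max-margin direction and coercivity on the span. -/

section Margin

variable {ι : Type*} [Fintype ι] {E : Type*} [NormedAddCommGroup E] [InnerProductSpace ℝ E]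
  {z : ι → E} {α : ι → ℝ}

lemma inner_sum_smul_eq_sum (hhat : ∀ i, ⟪∑ j, α j • z j, z i⟫ = 1) (v : ι → ℝ) :
    ⟪∑ i, v i • z i, ∑ j, α j • z j⟫ = ∑ i, v i := by
  rw [sum_inner]
  refine Finset.sum_congr rfl fun i _ => ?_
  rw [real_inner_smul_left, real_inner_comm, hhat, mul_one]

lemma norm_sq_eq_sum (hhat : ∀ i, ⟪∑ j, α j • z j, z i⟫ = 1) :
    ‖∑ j, α j • z j‖ ^ 2 = ∑ j, α j := by
  rw [← real_inner_self_eq_norm_sq, inner_sum_smul_eq_sum hhat]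

lemma norm_inv_eq_rpow (hhat : ∀ i, ⟪∑ j, α j • z j, z i⟫ = 1) :
    (∑ j, α j) ^ (-(1 / 2) : ℝ) = ‖∑ j, α j • z j‖⁻¹ := by
  rw [← norm_sq_eq_sum hhat, Real.rpow_neg (sq_nonneg _), ← Real.sqrt_eq_rpow,
    Real.sqrt_sq (norm_nonneg _)]

/-- Cauchy–Schwarz against `ŵ`; this bounds the gradient below by the sum of the slopes. -/
lemma norm_inv_mul_sum_le (hhat : ∀ i, ⟪∑ j, α j • z j, z i⟫ = 1) (v : ι → ℝ) :
    ‖∑ j, α j • z j‖⁻¹ * ∑ i, v i ≤ ‖∑ i, v i • z i‖ := by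
  rw [← inner_sum_smul_eq_sum hhat v]
  rcases (norm_nonneg (∑ j, α j • z j)).eq_or_lt with h | h
  · rw [← h]; simp
  · rw [inv_mul_le_iff₀ h, mul_comm]
    exact real_inner_le_norm _ _

lemma iInf_inner_mul_norm_sq_le [Nonempty ι] (hα : ∀ i, 0 < α i)
    (hhat : ∀ i, ⟪∑ j, α j • z j, z i⟫ = 1) (w : E) :
    (⨅ i, ⟪w, z i⟫) * ‖∑ j, α j • z j‖ ^ 2 ≤ ⟪w, ∑ j, α j • z j⟫ := by
  rw [norm_sq_eq_sum hhat, inner_sum, Finset.mul_sum]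
  refine Finset.sum_le_sum fun i _ => ?_
  rw [real_inner_smul_right, mul_comm]
  exact mul_le_mul_of_nonneg_left (ciInf_le (Set.finite_range _).bddBelow i) (hα i).le

lemma norm_sum_smul_pos [Nonempty ι] (hα : ∀ i, 0 < α i)
    (hhat : ∀ i, ⟪∑ j, α j • z j, z i⟫ = 1) : 0 < ‖∑ j, α j • z j‖ := by
  have h1 := norm_sq_eq_sum hhat
  have h2 : 0 < ∑ j, α j := Finset.sum_pos (fun j _ => hα j) Finset.univ_nonempty
  exact (norm_nonneg _).lt_of_ne fun h => by rw [← h] at h1; norm_num at h1; linarith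

lemma iInf_inner_normalized [Nonempty ι] (hhat : ∀ i, ⟪∑ j, α j • z j, z i⟫ = 1) :
    ⨅ i, ⟪‖∑ j, α j • z j‖⁻¹ • ∑ j, α j • z j, z i⟫ = ‖∑ j, α j • z j‖⁻¹ := by
  simp_rw [real_inner_smul_left, hhat, mul_one]
  exact ciInf_const

lemma iInf_inner_le [Nonempty ι] (hα : ∀ i, 0 < α i)
    (hhat : ∀ i, ⟪∑ j, α j • z j, z i⟫ = 1) {w : E} (hw : ‖w‖ = 1) :
    ⨅ i, ⟪w, z i⟫ ≤ ‖∑ j, α j • z j‖⁻¹ := by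
  have h0 := norm_sum_smul_pos hα hhat
  have h1 := iInf_inner_mul_norm_sq_le hα hhat w
  have h2 := real_inner_le_norm w (∑ j, α j • z j)
  rw [hw, one_mul] at h2
  have h3 := h1.trans h2
  rw [sq, ← mul_assoc] at h3
  rw [← one_div, le_div_iff₀ h0]
  exact le_of_mul_le_mul_right (h3.trans_eq (one_mul _).symm) h0

lemma eq_normalized_of_iInf_inner_eq [Nonempty ι] (hα : ∀ i, 0 < α i)
    (hhat : ∀ i, ⟪∑ j, α j • z j, z i⟫ = 1) {w : E} (hw : ‖w‖ = 1)
    (h : ⨅ i, ⟪w, z i⟫ = ‖∑ j, α j • z j‖⁻¹) :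
    w = ‖∑ j, α j • z j‖⁻¹ • ∑ j, α j • z j := by
  have h0 := norm_sum_smul_pos hα hhat
  have h1 := iInf_inner_mul_norm_sq_le hα hhat w
  have h2 := real_inner_le_norm w (∑ j, α j • z j)
  have h3 : ‖∑ j, α j • z j‖⁻¹ * ‖∑ j, α j • z j‖ ^ 2 = ‖∑ j, α j • z j‖ := by field_simp
  rw [h, h3] at h1
  rw [hw, one_mul] at h2
  have h4 : ⟪w, ∑ j, α j • z j⟫ = ‖w‖ * ‖∑ j, α j • z j‖ := by
    rw [hw, one_mul]; exact le_antisymm h2 h1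
  rw [inner_eq_norm_mul_iff_real, hw, one_smul] at h4
  exact (inv_smul_eq_iff₀ h0.ne').2 h4.symm |>.symm

/-- On the finite-dimensional span, `r ↦ (⟪r, z i⟫)ᵢ` is injective, since a vector of its kernel is
orthogonal to itself, and hence bounded below. -/
lemma exists_norm_sq_le_sum_inner_sq (z : ι → E) :
    ∃ M : ℝ, ∀ r ∈ Submodule.span ℝ (Set.range z), ‖r‖ ^ 2 ≤ M * ∑ i, ⟪r, z i⟫ ^ 2 := by
  set S := Submodule.span ℝ (Set.range z) with hS
  have : FiniteDimensional ℝ S := FiniteDimensional.span_of_finite ℝ (Set.finite_range z)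
  let Φ : S →ₗ[ℝ] EuclideanSpace ℝ ι :=
    { toFun := fun r => WithLp.toLp 2 fun i => ⟪(r : E), z i⟫
      map_add' := fun r s => by ext i; simp [inner_add_left]
      map_smul' := fun c r => by ext i; simp [real_inner_smul_left] }
  have hker : Φ.ker = ⊥ := by
    rw [LinearMap.ker_eq_bot']
    intro r hr
    have h1 : ∀ i, ⟪(r : E), z i⟫ = 0 := fun i => congrArg (fun v : EuclideanSpace ℝ ι => v i) hr
    have h2 : (r : E) ∈ Sᗮ := by
      rw [Submodule.mem_orthogonal']
      intro s hs
      induction hs using Submodule.span_induction with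
      | mem s hs => obtain ⟨i, rfl⟩ := hs; exact h1 i
      | zero => exact inner_zero_right _
      | add s t _ _ hs ht => rw [inner_add_right, hs, ht, add_zero]
      | smul c s _ hs => rw [real_inner_smul_right, hs, mul_zero]
    have h3 := Submodule.inner_right_of_mem_orthogonal r.2 h2
    exact Subtype.ext (inner_self_eq_zero.1 h3)
  obtain ⟨C, _, hC⟩ := Φ.exists_antilipschitzWith hker
  refine ⟨(C : ℝ) ^ 2, fun r hr => ?_⟩
  have h1 := hC.le_mul_norm_sub ⟨r, hr⟩ 0
  rw [map_zero, neg_add_eq_sub, neg_add_eq_sub, norm_sub_rev, sub_zero, norm_sub_rev,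
    sub_zero] at h1
  have h2 : ‖Φ ⟨r, hr⟩‖ ^ 2 = ∑ i, ⟪r, z i⟫ ^ 2 := by
    rw [EuclideanSpace.real_norm_sq_eq]
    rfl
  rw [← h2, ← mul_pow]
  exact pow_le_pow_left₀ (norm_nonneg _) h1 2

end Margin

/-! ### The largest singular value as an operator bound. -/

section SingularValues

/-- Expand `‖T v‖² = ⟪v, T†T v⟫` in an eigenbasis of `T†T`, whose eigenvalues are the squared
singular values. -/
lemma norm_apply_sq_le_singularValues_zero {E F : Type*} [NormedAddCommGroup E]
    [InnerProductSpace ℝ E] [FiniteDimensional ℝ E] [NormedAddCommGroup F] [InnerProductSpace ℝ F]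
    [FiniteDimensional ℝ F] (T : E →ₗ[ℝ] F) (v : E) :
    ‖T v‖ ^ 2 ≤ T.singularValues 0 ^ 2 * ‖v‖ ^ 2 := by
  have hT := T.isSymmetric_adjoint_comp_self
  set b := hT.eigenvectorBasis rfl with hb
  have h1 : ‖T v‖ ^ 2 = ∑ i, ⟪v, b i⟫ * ⟪b i, (LinearMap.adjoint T ∘ₗ T) v⟫ := by
    rw [b.sum_inner_mul_inner, LinearMap.comp_apply, LinearMap.adjoint_inner_right,
      real_inner_self_eq_norm_sq]
  rw [h1, ← b.sum_sq_norm_inner_right v, Finset.mul_sum]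
  refine Finset.sum_le_sum fun i _ => ?_
  have h2 : ⟪b i, (LinearMap.adjoint T ∘ₗ T) v⟫ = T.singularValues i ^ 2 * ⟪b i, v⟫ := by
    rw [← hT, hT.apply_eigenvectorBasis rfl i, T.sq_singularValues_fin rfl i]
    simp [hb, real_inner_smul_left]
  have h3 : T.singularValues i ^ 2 ≤ T.singularValues 0 ^ 2 :=
    pow_le_pow_left₀ (T.singularValues_nonneg _) (T.singularValues_antitone (Nat.zero_le _)) 2
  rw [h2, real_inner_comm, Real.norm_eq_abs, sq_abs]
  nlinarith [mul_le_mul_of_nonneg_right h3 (sq_nonneg ⟪b i, v⟫)]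

end SingularValues

/-! ### The data matrix, its Gram matrix and the loss gradient. -/

section Data

variable {d N : ℕ} {x : Fin N → EuclideanSpace ℝ (Fin d)} {y : Fin N → ℝ}

/-- The signed examples `y_i x_i`. -/
noncomputable def signed (x : Fin N → EuclideanSpace ℝ (Fin d)) (y : Fin N → ℝ) (i : Fin N) :
    EuclideanSpace ℝ (Fin d) := y i • x i

lemma inner_signed (w : EuclideanSpace ℝ (Fin d)) (i : Fin N) :
    ⟪w, signed x y i⟫ = y i * ⟪w, x i⟫ := real_inner_smul_right _ _ _

lemma toLp_dataMatrix_mulVec (v : Fin N → ℝ) :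
    WithLp.toLp 2 (dataMatrix x y *ᵥ v) = ∑ i, v i • signed x y i := by
  ext k
  simp [dataMatrix, signed, Matrix.mulVec, dotProduct]
  exact Finset.sum_congr rfl fun i _ => by ring

lemma gram_mulVec (v : Fin N → ℝ) (i : Fin N) :
    (((dataMatrix x y)ᵀ * dataMatrix x y) *ᵥ v) i = ⟪∑ j, v j • signed x y j, signed x y i⟫ := by
  rw [← toLp_dataMatrix_mulVec, ← Matrix.mulVec_mulVec, PiLp.inner_apply]
  simp [Matrix.mulVec, dotProduct, dataMatrix, signed]

/-- If `XᵀX v = 0` then `‖X v‖² = 0`, and the columns of `X` are independent because signs do not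
affect independence. -/
lemma isUnit_gram (hy : ∀ i, y i = 1 ∨ y i = -1) (hx : LinearIndependent ℝ x) :
    IsUnit ((dataMatrix x y)ᵀ * dataMatrix x y) := by
  rw [← Matrix.mulVec_injective_iff_isUnit]
  refine (injective_iff_map_eq_zero ((dataMatrix x y)ᵀ * dataMatrix x y).mulVecLin).2 ?_
  intro v hv
  have h1 : ∑ j, v j • signed x y j = 0 := by
    rw [← inner_self_eq_zero (𝕜 := ℝ)]
    conv_lhs => rw [inner_sum]
    refine Finset.sum_eq_zero fun i _ => ?_
    rw [real_inner_smul_right, ← gram_mulVec]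
    have := congrFun hv i
    simp only [Matrix.mulVecLin_apply] at this
    rw [this]
    simp
  have h2 : ∑ j, (v j * y j) • x j = 0 := by
    rw [← h1]
    exact Finset.sum_congr rfl fun j _ => by rw [signed, smul_smul]
  have h3 := Fintype.linearIndependent_iff.1 hx _ h2
  ext i
  rcases hy i with h | h <;> simpa [h] using h3 i

lemma norm_sum_signed_sq_le (v : Fin N → ℝ) :
    ‖∑ i, v i • signed x y i‖ ^ 2 ≤ sigmaMax (dataMatrix x y) ^ 2 * ∑ i, v i ^ 2 := by
  have := norm_apply_sq_le_singularValues_zero (Matrix.toEuclideanLin (dataMatrix x y))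
    (WithLp.toLp 2 v)
  rw [Matrix.toLpLin_toLp, Matrix.toLin'_apply, toLp_dataMatrix_mulVec,
    EuclideanSpace.real_norm_sq_eq (WithLp.toLp 2 v)] at this
  exact this

/-- The bound for `X` passes to `Xᵀ`: `‖Xᵀw‖² = ⟪w, X Xᵀw⟫ ≤ ‖w‖ σ ‖Xᵀw‖`. -/
lemma sum_inner_signed_sq_le (w : EuclideanSpace ℝ (Fin d)) :
    ∑ i, ⟪w, signed x y i⟫ ^ 2 ≤ sigmaMax (dataMatrix x y) ^ 2 * ‖w‖ ^ 2 := by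
  set S := ∑ i, ⟪w, signed x y i⟫ ^ 2 with hS
  set σ := sigmaMax (dataMatrix x y)
  have hS0 : 0 ≤ S := Finset.sum_nonneg fun i _ => sq_nonneg _
  have h1 := norm_sum_signed_sq_le (x := x) (y := y) fun i => ⟪w, signed x y i⟫
  have h2 : S = ⟪w, ∑ i, ⟪w, signed x y i⟫ • signed x y i⟫ := by
    rw [inner_sum, hS]
    exact Finset.sum_congr rfl fun i _ => by rw [real_inner_smul_right, sq]
  have h3 := real_inner_le_norm w (∑ i, ⟪w, signed x y i⟫ • signed x y i)
  rw [← h2] at h3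
  have h4 : S * S ≤ S * (σ ^ 2 * ‖w‖ ^ 2) := by
    calc S * S ≤ (‖w‖ * ‖∑ i, ⟪w, signed x y i⟫ • signed x y i‖) ^ 2 := by
          rw [← sq]; gcongr
      _ = ‖w‖ ^ 2 * ‖∑ i, ⟪w, signed x y i⟫ • signed x y i‖ ^ 2 := by ring
      _ ≤ ‖w‖ ^ 2 * (σ ^ 2 * S) := by gcongr
      _ = _ := by ring
  rcases hS0.eq_or_lt with h | h
  · rw [← h]; positivity
  · exact le_of_mul_le_mul_left h4 h

lemma hasGradientAt_batchLoss (S : Finset (Fin N)) (w : EuclideanSpace ℝ (Fin d)) :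
    HasGradientAt (batchLoss x y S)
      (-∑ i ∈ S, lossSlope ⟪w, signed x y i⟫ • signed x y i) w := by
  rw [hasGradientAt_iff_hasFDerivAt]
  have h1 : ∀ i, HasFDerivAt (fun w => exampleLoss x y w i)
      (-lossSlope ⟪w, signed x y i⟫ • innerSL ℝ (signed x y i)) w := by
    intro i
    have h2 : HasFDerivAt (fun w : EuclideanSpace ℝ (Fin d) => ⟪w, signed x y i⟫)
        (innerSL ℝ (signed x y i)) w := by
      refine (innerSL ℝ (signed x y i)).hasFDerivAt.congr_of_eventuallyEq
        (Eventually.of_forall fun v => ?_)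
      exact real_inner_comm _ _
    have h3 := (hasDerivAt_logisticLoss ⟪w, signed x y i⟫).comp_hasFDerivAt w h2
    refine h3.congr_of_eventuallyEq (Eventually.of_forall fun v => ?_)
    simp [exampleLoss, inner_signed]
  have h4 := HasFDerivAt.fun_sum (u := S) fun i _ => h1 i
  refine h4.congr_fderiv ?_
  ext v
  simp

end Data

/-! ### Step-size conditions and the passage from SGD to abstract epochs. -/

section Training

variable {d N : ℕ} {x : Fin N → EuclideanSpace ℝ (Fin d)} {y : Fin N → ℝ}

/-- As `σ/γ ≥ 1`, the quantity `b = ησ³/4` satisfies `2b(k + 1) ≤ γ`; then `(k + 1)² ≥ 4k` gives `16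
b² k ≤ γ²`. -/
lemma step_size_bounds {σ γ η k : ℝ} (hγ : 0 < γ) (hγσ : γ ≤ σ) (hη : 0 < η) (hk : 1 ≤ k)
    (h : η < γ / (2 * beta * σ ^ 3 * (k + σ / γ))) :
    η * σ ^ 2 ≤ 1 ∧ (η * σ ^ 2 / 4) ^ 2 * k * σ ^ 2 ≤ γ ^ 2 / 16 := by
  have hσ : 0 < σ := hγ.trans_le hγσ
  have hs : 1 ≤ σ / γ := (one_le_div₀ hγ).2 hγσ
  rw [beta, lt_div_iff₀ (by positivity)] at h
  set b := η * σ ^ 2 / 4 * σ with hb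
  have hb0 : 0 < b := by positivity
  have h1 : b * (2 * (k + 1)) ≤ γ := by
    have h2 : b * (2 * (k + 1)) ≤ b * (2 * (k + σ / γ)) := by gcongr
    have h3 : b * (2 * (k + σ / γ)) = η * (2 * (1 / 4) * σ ^ 3 * (k + σ / γ)) := by rw [hb]; ring
    linarith
  constructor
  · have h2 : b * 4 ≤ σ := by nlinarith
    have h3 : η * σ ^ 2 * σ ≤ 1 * σ := by rw [hb] at h2; linarith
    exact le_of_mul_le_mul_right h3 hσ
  · have h2 : (b * (2 * (k + 1))) ^ 2 ≤ γ ^ 2 := by gcongr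
    have h3 : (η * σ ^ 2 / 4) ^ 2 * k * σ ^ 2 = b ^ 2 * k := by rw [hb]; ring
    rw [h3]
    nlinarith [mul_nonneg (sq_nonneg b) (sq_nonneg (k - 1))]

lemma wHat_eq (α : Fin N → ℝ) : wHat x y α = ∑ i, α i • signed x y i :=
  toLp_dataMatrix_mulVec α

lemma margin_eq (w : EuclideanSpace ℝ (Fin d)) : margin x y w = ⨅ i, ⟪w, signed x y i⟫ := by
  simp_rw [margin, inner_signed]

lemma exampleLoss_eq (w : EuclideanSpace ℝ (Fin d)) (i : Fin N) :
    exampleLoss x y w i = logisticLoss ⟪w, signed x y i⟫ := by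
  rw [exampleLoss, inner_signed]

lemma isAdmissible_signed {σ η : ℝ} {K : ℕ} (hN : 0 < N) {α : Fin N → ℝ} (hα : ∀ i, 0 < α i)
    (hhat : ∀ i, ⟪∑ j, α j • signed x y j, signed x y i⟫ = 1) (hK : 0 < K) (hη : 0 < η)
    (hσ : σ = sigmaMax (dataMatrix x y))
    (h : η < gammaStar α / (2 * beta * σ ^ 3 * (K + σ / gammaStar α))) :
    IsAdmissible (signed x y) σ (gammaStar α) η K := by
  have : Nonempty (Fin N) := ⟨⟨0, hN⟩⟩
  have hn0 := norm_sum_smul_pos hα hhat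
  have hγ : gammaStar α = ‖∑ j, α j • signed x y j‖⁻¹ := norm_inv_eq_rpow hhat
  have hγ0 : 0 < gammaStar α := by rw [hγ]; positivity
  have hσ0 : 0 ≤ σ := hσ ▸ LinearMap.singularValues_nonneg _ _
  have hγσ : gammaStar α ≤ σ := by
    have h1 := sum_inner_signed_sq_le (x := x) (y := y) (∑ j, α j • signed x y j)
    simp only [hhat, one_pow, Finset.sum_const, Finset.card_univ, Fintype.card_fin, nsmul_eq_mul,
      mul_one, ← hσ] at h1
    have h2 : (1 : ℝ) ≤ N := by exact_mod_cast hN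
    rw [← mul_pow] at h1
    have h3 := one_le_pow_iff_of_nonneg (mul_nonneg hσ0 hn0.le) two_ne_zero |>.1 (h2.trans h1)
    rwa [hγ, inv_le_iff_one_le_mul₀ hn0]
  obtain ⟨h1, h2⟩ := step_size_bounds hγ0 hγσ hη (by exact_mod_cast hK) h
  exact ⟨hη, hγ0, hγσ, h1, h2, hσ ▸ norm_sum_signed_sq_le, hσ ▸ sum_inner_signed_sq_le,
    hγ ▸ norm_inv_mul_sum_le hhat⟩

lemma sgd_succ (η : ℝ) (batch : ℕ → Finset (Fin N)) (w₀ : EuclideanSpace ℝ (Fin d)) (t : ℕ) :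
    sgd x y η batch w₀ (t + 1) = sgd x y η batch w₀ t
      + η • ∑ i ∈ batch t, lossSlope ⟪sgd x y η batch w₀ t, signed x y i⟫ • signed x y i := by
  rw [sgd, (hasGradientAt_batchLoss _ _).gradient, smul_neg, sub_neg_eq_add]

lemma IsEpochwise.exists_isEpoch {K : ℕ} {batch : ℕ → Finset (Fin N)}
    (h : IsEpochwise K batch) (η : ℝ) (w₀ : EuclideanSpace ℝ (Fin d)) :
    ∃ κ : ℕ → Fin N → ℕ, ∀ e, IsEpoch (signed x y) η K (κ e)
      (fun k => sgd x y η batch w₀ (e * K + k)) := by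
  choose κ hκ huniq using h.existsUnique_mem
  refine ⟨fun e i => κ e i, fun e => ⟨fun i => (κ e i).2, fun k hk => ?_⟩⟩
  have hmem : ∀ i, i ∈ batch (e * K + k) ↔ (κ e i : ℕ) = k := by
    intro i
    constructor
    · intro hi
      exact (congrArg Fin.val (huniq e i ⟨k, hk⟩ hi)).symm
    · rintro rfl
      exact hκ e i
  rw [← add_assoc, sgd_succ]
  congr 2
  simp_rw [ite_smul, zero_smul, ← hmem]
  rw [Finset.sum_ite_mem, Finset.univ_inter]

lemma sgd_sub_mem_span (η : ℝ) (batch : ℕ → Finset (Fin N)) (w₀ : EuclideanSpace ℝ (Fin d))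
    (t : ℕ) : sgd x y η batch w₀ t - w₀ ∈ Submodule.span ℝ (Set.range (signed x y)) := by
  induction t with
  | zero => simp [sgd]
  | succ t ih =>
    rw [sgd_succ, add_sub_right_comm]
    refine add_mem ih (Submodule.smul_mem _ _ (Submodule.sum_mem _ fun i _ =>
      Submodule.smul_mem _ _ (Submodule.subset_span ⟨i, rfl⟩)))

lemma sum_smul_mem_span_range {ι E : Type*} [Fintype ι] [AddCommGroup E] [Module ℝ E]
    (z : ι → E) (v : ι → ℝ) : ∑ i, v i • z i ∈ Submodule.span ℝ (Set.range z) :=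
  Submodule.sum_mem _ fun i _ => Submodule.smul_mem _ _ (Submodule.subset_span ⟨i, rfl⟩)

/-- Every vector of margins is attained on the affine space through `w₀` that is spanned by the
examples. -/
lemma exists_inner_signed_eq (hy : ∀ i, y i = 1 ∨ y i = -1) (hx : LinearIndependent ℝ x)
    (w₀ : EuclideanSpace ℝ (Fin d)) (c : Fin N → ℝ) :
    ∃ u, (∀ i, ⟪u, signed x y i⟫ = c i) ∧
      u - w₀ ∈ Submodule.span ℝ (Set.range (signed x y)) := by
  obtain ⟨v, hv⟩ := Matrix.mulVec_surjective_iff_isUnit.2 (isUnit_gram hy hx)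
    (fun i => c i - ⟪w₀, signed x y i⟫)
  refine ⟨w₀ + ∑ j, v j • signed x y j, fun i => ?_, ?_⟩
  · have := congrFun hv i
    rw [gram_mulVec] at this
    rw [inner_add_left, this]
    ring
  · rw [add_sub_cancel_left]
    exact sum_smul_mem_span_range _ _

end Training

end MinibatchSGD

open MinibatchSGD

theorem mainTheorem2 {d N : ℕ} (hN : 0 < N)
    (x : Fin N → EuclideanSpace ℝ (Fin d)) (y : Fin N → ℝ)
    (hy : ∀ i, y i = 1 ∨ y i = -1) (hx : LinearIndependent ℝ x) :
    (∃! α : Fin N → ℝ,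
      ((MinibatchSGD.dataMatrix x y)ᵀ * MinibatchSGD.dataMatrix x y) *ᵥ α = fun _ => 1) ∧
    ∀ α : Fin N → ℝ,
      ((MinibatchSGD.dataMatrix x y)ᵀ * MinibatchSGD.dataMatrix x y) *ᵥ α = (fun _ => 1) →
      (∀ i, 0 < α i) →
      -- `γ*` is the maximum normalized margin, and `ŵ` is the max-margin direction
      (IsGreatest (MinibatchSGD.margin x y '' {w | ‖w‖ = 1}) (MinibatchSGD.gammaStar α) ∧
        ∀ w : EuclideanSpace ℝ (Fin d), ‖w‖ = 1 →
          (MinibatchSGD.margin x y w = MinibatchSGD.gammaStar α ↔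
            w = ‖MinibatchSGD.wHat x y α‖⁻¹ • MinibatchSGD.wHat x y α)) ∧
      -- convergence of the SGD iterates and of the loss shares
      ∀ (K : ℕ), 0 < K → K ∣ N → ∀ η : ℝ, 0 < η →
        η < min
          (1 / (2 * K * MinibatchSGD.beta
            * MinibatchSGD.sigmaMax (MinibatchSGD.dataMatrix x y) ^ 2))
          (MinibatchSGD.gammaStar α / (2 * MinibatchSGD.beta
            * MinibatchSGD.sigmaMax (MinibatchSGD.dataMatrix x y) ^ 3
            * (K + MinibatchSGD.sigmaMax (MinibatchSGD.dataMatrix x y)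
                / MinibatchSGD.gammaStar α))) →
        ∀ w₀ : EuclideanSpace ℝ (Fin d), ∃ wTilde : EuclideanSpace ℝ (Fin d),
          (∀ i, Real.exp (-(y i * ⟪wTilde, x i⟫)) = α i / η) ∧
          ∀ batch : ℕ → Finset (Fin N), MinibatchSGD.IsEpochwise K batch →
            Tendsto (fun t : ℕ => ‖MinibatchSGD.sgd x y η batch w₀ t
                - Real.log ((t : ℝ) / K) • MinibatchSGD.wHat x y α - wTilde‖) atTop (𝓝 0) ∧
            ∀ i, Tendsto (fun t : ℕ =>
                MinibatchSGD.exampleLoss x y (MinibatchSGD.sgd x y η batch w₀ t) i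
                  / ∑ j, MinibatchSGD.exampleLoss x y (MinibatchSGD.sgd x y η batch w₀ t) j)
              atTop (𝓝 (α i / ∑ j, α j)) := by
  have : Nonempty (Fin N) := ⟨⟨0, hN⟩⟩
  have hunit := isUnit_gram hy hx
  refine ⟨?_, fun α hG hα => ?_⟩
  · obtain ⟨α, hα⟩ := Matrix.mulVec_surjective_iff_isUnit.2 hunit (fun _ => 1)
    exact ⟨α, hα, fun α' hα' =>
      Matrix.mulVec_injective_iff_isUnit.2 hunit (hα'.trans hα.symm)⟩
  have hhat : ∀ i, ⟪∑ j, α j • signed x y j, signed x y i⟫ = 1 := fun i => by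
    rw [← gram_mulVec, hG]
  have hγ : gammaStar α = ‖∑ j, α j • signed x y j‖⁻¹ := norm_inv_eq_rpow hhat
  have hn0 := norm_sum_smul_pos hα hhat
  refine ⟨⟨⟨?_, ?_⟩, fun w hw => ?_⟩, fun K hK _ η hη hlt w₀ => ?_⟩
  · refine ⟨‖∑ j, α j • signed x y j‖⁻¹ • ∑ j, α j • signed x y j, ?_, ?_⟩
    · rw [Set.mem_ofPred_eq, norm_smul, norm_inv, norm_norm, inv_mul_cancel₀ hn0.ne']
    · rw [margin_eq, iInf_inner_normalized hhat, hγ]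
  · rintro _ ⟨w, hw, rfl⟩
    rw [margin_eq, hγ]
    exact iInf_inner_le hα hhat hw
  · rw [margin_eq, hγ, wHat_eq]
    constructor
    · exact eq_normalized_of_iInf_inner_eq hα hhat hw
    · rintro rfl
      exact iInf_inner_normalized hhat
  · have ha := isAdmissible_signed hN hα hhat hK hη rfl (hlt.trans_le (min_le_right _ _))
    -- The limit offset is fixed before the minibatches. Choosing it in `w₀ + span`, where all
    -- iterates remain, keeps the residual in the span of the examples.
    obtain ⟨u, hu, humem⟩ := exists_inner_signed_eq hy hx w₀ fun i => -Real.log (α i / η)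
    have hexp : ∀ i, Real.exp (-⟪u, signed x y i⟫) = α i / η := fun i => by
      rw [hu, neg_neg, Real.exp_log (div_pos (hα i) hη)]
    refine ⟨u, fun i => by rw [← inner_signed, hexp], fun batch hbatch => ?_⟩
    obtain ⟨κ, hκ⟩ := hbatch.exists_isEpoch (x := x) (y := y) η w₀
    obtain ⟨M, hM⟩ := exists_norm_sq_le_sum_inner_sq (signed x y)
    have hlim := tendsto_norm_sub_log hK ha hκ hα hhat hexp (M := M) fun e => hM _ (by
      have h1 := sgd_sub_mem_span (x := x) (y := y) η batch w₀ (e * K)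
      have h2 := Submodule.smul_mem _ (Real.log e) (sum_smul_mem_span_range (signed x y) α)
      have h3 := sub_mem (sub_mem h1 h2) humem
      convert h3 using 1
      unfold MinibatchSGD.residual
      abel)
    refine ⟨?_, fun i => ?_⟩
    · simpa only [wHat_eq] using hlim
    · simpa only [exampleLoss_eq] using tendsto_loss_share hK ha hα hhat hexp hlim i
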